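/- Let $\Lambda$ be the hexagonal-lattice torus of side $L$: its $2L^2$ sites are the faces of the triangular lattice in a rhombus of side $L$ along two lattice axes, with periodic boundary conditions, and two sites are nearest neighbours when the corresponding faces share an edge. For $\sigma\in\mathcal X=\{-1,+1\}^\Lambda$ let $$H(\sigma)=-\frac J2\sum_{\{i,j\}\ \text{nearest neighbours}}\sigma(i)\sigma(j)-\frac h2\sum_{i\in\Lambda}\sigma(i),$$ each pair being counted once. Assume $0<h<1$, $J\ge 2h$, $\frac{J}{2h}-\frac12\notin\mathbb Z$ and $|\Lambda|\ge(4J/h)^2$. For $\beta>0$ let $(X_t)_{t\in\mathbb N}$ be the Metropolis chain on $\mathcal X$: for $\eta\ne\sigma$, $P(\sigma,\eta)=\frac1{|\Lambda|}e^{-\beta\max(H(\eta)-H(\sigma),0)}$ if $\eta$ is obtained from $\sigma$ by flipping one spin and $P(\sigma,\eta)=0$ otherwise, and $P(\sigma,\sigma)=1-\sum_{\eta\neq\sigma}P(\sigma,\eta)$. Write $\mathbb P_{\underline{-1}}$ and $\mathbb E_{\underline{-1}}$ for probability and expectation for the chain started from the configuration $\underline{-1}$ with all spins $-1$, and let $\tau_{\underline{+1}}=\inf\{t>0: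 X_t=\underline{+1}\}$ be the first hitting time of the configuration $\underline{+1}$ with all spins $+1$. Let $$T_\beta=\inf\{n\ge1:\ \mathbb P_{\underline{-1}}(\tau_{\underline{+1}}\le n)\ge 1-e^{-1}\}.$$ Then, with $L$, $J$, $h$ fixed, $$\lim_{\beta\to\infty}\mathbb P_{\underline{-1}}(\tau_{\underline{+1}}>tT_\beta)=e^{-t}\quad\text{for every } t\ge0,\qquad\text{and}\qquad \lim_{\beta\to\infty}\frac{\mathbb E_{\underline{-1}}[\tau_{\underline{+1}}]}{T_\beta}=1 .$$ -/

import Mathlib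

open MeasureTheory ProbabilityTheory Filter Topology
open scoped NNReal ENNReal

namespace HexIsing

/-- The sites of the `L × L` torus. The cell `(a, b)` of the triangular lattice (coordinates along
two of its axes, taken modulo `L`) is split into an upper-pointing face `Sum.inl (a, b)`, with
vertices `(a, b), (a+1, b), (a, b+1)`, and a lower-pointing face `Sum.inr (a, b)`, with vertices
`(a+1, b), (a, b+1), (a+1, b+1)`. The sites of the hexagonal lattice are the centres of the
triangular faces. -/
abbrev Site (L : ℕ) : Type := (ZMod L × ZMod L) ⊕ (ZMod L × ZMod L)

/-- The upper-pointing face of the cell `u` has a common edge with the lower-pointing face of the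
cell `d`. -/
def ShareEdge {L : ℕ} (u d : ZMod L × ZMod L) : Prop :=
  d = u ∨ d = (u.1 - 1, u.2) ∨ d = (u.1, u.2 - 1)

/-- The hexagonal lattice with periodic boundary conditions: sites at lattice distance one are
adjacent, that is, the corresponding triangular faces have a common edge. -/
def hexTorus (L : ℕ) : SimpleGraph (Site L) where
  Adj
    | .inl u, .inr d => ShareEdge u d
    | .inr d, .inl u => ShareEdge u d
    | _, _ => False
  symm := ⟨by rintro (u | u) (d | d) h <;> exact h⟩
  loopless := ⟨by rintro (u | u) h <;> exact h⟩

/-- Spin configurations `Λ → {-1, +1}`. -/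
abbrev Config (L : ℕ) : Type := Site L → ℤˣ

/-- The spin `σ(i)` as a real number. -/
def spin {L : ℕ} (σ : Config L) (i : Site L) : ℝ := ((σ i : ℤ) : ℝ)

open scoped Classical in
/-- The Hamiltonian; the interaction runs over the pairs of nearest neighbours, each pair counted
once. -/
noncomputable def energy {L : ℕ} [NeZero L] (J h : ℝ) (σ : Config L) : ℝ :=
  -(J / 2) * ∑ e ∈ (hexTorus L).edgeFinset, (e.map (spin σ)).mul - (h / 2) * ∑ i, spin σ i

/-- The configuration `σ^(x)`, obtained from `σ` by flipping the spin at `x`. -/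
def flip {L : ℕ} (σ : Config L) (x : Site L) : Config L := Function.update σ x (-σ x)

open scoped Classical in
/-- The connectivity matrix `q(σ, η)`, for `σ ≠ η`. -/
noncomputable def connectivity {L : ℕ} [NeZero L] (σ η : Config L) : ℝ :=
  if ∃ x, flip σ x = η then 1 / (Fintype.card (Site L) : ℝ) else 0

/-- The Metropolis probability `q(σ, η) exp (-β [H(η) - H(σ)]₊)` of a jump from `σ` to `η ≠ σ`. -/
noncomputable def jumpProb {L : ℕ} [NeZero L] (J h : ℝ) (β : ℝ≥0) (σ η : Config L) : ℝ :=
  connectivity σ η * Real.exp (-(β : ℝ) * max (energy J h η - energy J h σ) 0)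

/-- The transition matrix of the Metropolis dynamics. -/
noncomputable def transProb {L : ℕ} [NeZero L] (J h : ℝ) (β : ℝ≥0) (σ η : Config L) : ℝ :=
  if η = σ then 1 - ∑ ζ ∈ Finset.univ.erase σ, jumpProb J h β σ ζ else jumpProb J h β σ η

section Stochastic

variable {L : ℕ} [NeZero L] (J h : ℝ) (β : ℝ≥0) (σ : Config L)

lemma connectivity_nonneg (η : Config L) : 0 ≤ connectivity σ η := by
  unfold connectivity
  split_ifs <;> positivity

lemma jumpProb_nonneg (η : Config L) : 0 ≤ jumpProb J h β σ η :=
  mul_nonneg (connectivity_nonneg σ η) (Real.exp_pos _).le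

lemma sum_jumpProb_le_one : ∑ ζ ∈ Finset.univ.erase σ, jumpProb J h β σ ζ ≤ 1 := by
  classical
  calc ∑ ζ ∈ Finset.univ.erase σ, jumpProb J h β σ ζ
      ≤ ∑ ζ, jumpProb J h β σ ζ :=
        Finset.sum_le_sum_of_subset_of_nonneg (Finset.erase_subset _ _)
          fun ζ _ _ => jumpProb_nonneg J h β σ ζ
    _ ≤ ∑ ζ, connectivity σ ζ := by
        refine Finset.sum_le_sum fun ζ _ => ?_
        refine mul_le_of_le_one_right (connectivity_nonneg σ ζ) (Real.exp_le_one_iff.2 ?_)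
        have : 0 ≤ (β : ℝ) * max (energy J h ζ - energy J h σ) 0 :=
          mul_nonneg β.2 (le_max_right _ _)
        linarith
    _ = ((Finset.univ.image (flip σ)).card : ℝ) * (1 / (Fintype.card (Site L) : ℝ)) := by
        unfold connectivity
        rw [← Finset.sum_filter, Finset.sum_const, nsmul_eq_mul]
        congr 3
        ext ζ
        simp
    _ ≤ (Fintype.card (Site L) : ℝ) * (1 / (Fintype.card (Site L) : ℝ)) := by
        refine mul_le_mul_of_nonneg_right ?_ (by positivity)
        exact_mod_cast Finset.card_image_le
    _ ≤ 1 := by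
        rw [mul_one_div]
        exact div_self_le_one _

lemma transProb_nonneg (η : Config L) : 0 ≤ transProb J h β σ η := by
  unfold transProb
  split_ifs
  · linarith [sum_jumpProb_le_one J h β σ]
  · exact jumpProb_nonneg J h β σ η

lemma sum_transProb : ∑ η, transProb J h β σ η = 1 := by
  rw [← Finset.add_sum_erase _ _ (Finset.mem_univ σ)]
  have : ∑ η ∈ Finset.univ.erase σ, transProb J h β σ η
      = ∑ η ∈ Finset.univ.erase σ, jumpProb J h β σ η :=
    Finset.sum_congr rfl fun η hη => if_neg (Finset.ne_of_mem_erase hη)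
  rw [this, transProb, if_pos rfl]
  ring

/-- The law of one step of the dynamics from `σ`. -/
noncomputable def stepPMF : PMF (Config L) :=
  PMF.ofFintype (fun η => ENNReal.ofReal (transProb J h β σ η)) (by
    rw [← ENNReal.ofReal_sum_of_nonneg fun η _ => transProb_nonneg J h β σ η, sum_transProb,
      ENNReal.ofReal_one])

end Stochastic

instance : DiscreteMeasurableSpace ℤˣ :=
  ⟨fun s => ⟨Units.val '' s, trivial, Set.preimage_image_eq s Units.val_injective⟩⟩

/-- The transition kernel of the Metropolis dynamics. -/
noncomputable def stepKernel {L : ℕ} [NeZero L] (J h : ℝ) (β : ℝ≥0) :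
    Kernel (Config L) (Config L) :=
  Kernel.ofFunOfCountable fun σ => (stepPMF J h β σ).toMeasure

instance {L : ℕ} [NeZero L] (J h : ℝ) (β : ℝ≥0) :
    IsMarkovKernel (stepKernel (L := L) J h β) :=
  ⟨fun σ => PMF.toMeasure.isProbabilityMeasure (stepPMF J h β σ)⟩

/-- The law `ℙ_σ` on trajectories `X₀, X₁, X₂, …` of the Metropolis chain started from `σ`. -/
noncomputable def chainLaw {L : ℕ} [NeZero L] (J h : ℝ) (β : ℝ≥0) (σ : Config L) :
    Measure (ℕ → Config L) :=
  Kernel.trajMeasure (X := fun _ => Config L) (Measure.dirac σ) fun n =>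
    (stepKernel J h β).comap (fun x => x ⟨n, Finset.mem_Iic.2 le_rfl⟩) (measurable_pi_apply _)

/-- The first hitting time `inf {t > 0 | X_t ∈ A}` of a trajectory, `∞` if `A` is never hit. -/
noncomputable def hitTime {L : ℕ} (A : Set (Config L)) (X : ℕ → Config L) : ℕ∞ :=
  hittingAfter (fun t (Y : ℕ → Config L) => Y t) A 1 X

/-- The configuration with all spins `-1`. -/
def allMinus (L : ℕ) : Config L := fun _ => -1

/-- The configuration with all spins `+1`. -/
def allPlus (L : ℕ) : Config L := fun _ => 1

/-- `T_β = inf {n ≥ 1 | ℙ_{-1}(τ_{+1} ≤ n) ≥ 1 - e⁻¹}`. -/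
noncomputable def quantileTime (L : ℕ) [NeZero L] (J h : ℝ) (β : ℝ≥0) : ℕ :=
  sInf {n : ℕ | 1 ≤ n ∧
    1 - Real.exp (-1) ≤ (chainLaw J h β (allMinus L)).real {X | hitTime {allPlus L} X ≤ n}}

/-- The mean hitting time `𝔼_{-1}[τ_{+1}]`, possibly infinite. -/
noncomputable def meanHitTime (L : ℕ) [NeZero L] (J h : ℝ) (β : ℝ≥0) : ℝ≥0∞ :=
  ∫⁻ X, (hitTime {allPlus L} X : ℝ≥0∞) ∂(chainLaw J h β (allMinus L))

end HexIsing

/-!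
Every configuration other than `-1` and `+1` can reach a better one (lower energy, ties being broken
by the pointwise order) by climbing at most `2 J`. Indeed, in a configuration where this fails, a
boundary side of length `n` of the plus region can be filled along its outside, which costs
`J - (2 n - 1) h`, or emptied along its inside, which costs `-J + (2 n + 1) h`. Neither move being
profitable, `(2 n - 1) h < J ≤ (2 n + 1) h`, so that all sides have the same length `n`. Treating
the two sides meeting at a corner one after the other costs `2 J - 4 n h` or `-2 J + 4 n h`, so that
`2 n h < J` and `J ≤ 2 n h`. A boundary line wrapping around the torus has no corner, but the row
along it can be filled at a profit. Hence there is no boundary: the configuration is constant.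

A Poincaré inequality along these paths shows that the chain hits `{-1, +1}` before a time of order
`exp (β V)` with overwhelming probability as soon as `V > 2 J`. Leaving `-1` takes a flip of cost
`3 J - h`, so for `2 J < V < 3 J - h` the chain started from `-1` has most likely not moved by then.
Since it is back at `-1` or absorbed in `+1` after a negligible time, its tail `n ↦ ℙ(τ > n)` is
multiplicative up to a vanishing error. Hence the exponential limit on the scale `T_β`, and a
uniform geometric bound on the tail gives the convergence of the mean.
-/

namespace HexIsing

section EdgeSums

variable {V W R : Type*}

lemma sum_edgeFinset_comp [AddCommMonoid R] {G : SimpleGraph V} {G' : SimpleGraph W}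
    [Fintype G.edgeSet] [Fintype G'.edgeSet] (φ : G ≃g G') (f : Sym2 W → R) :
    ∑ e ∈ G.edgeFinset, f (e.map φ) = ∑ e ∈ G'.edgeFinset, f e := by
  refine Finset.sum_nbij (Sym2.map φ) (fun e he => ?_)
    (fun e _ e' _ hee' => Sym2.map.injective φ.injective hee') (fun e he => ?_) fun _ _ => rfl
  · induction e with | _ x y => simpa [φ.map_adj_iff] using he
  · refine ⟨e.map φ.symm, ?_, ?_⟩ <;> induction e with | _ x y => simp_all [φ.symm.map_adj_iff]

variable [Fintype V] [DecidableEq V] [CommRing R] (G : SimpleGraph V) [DecidableRel G.Adj]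

lemma sum_incidenceFinset (x : V) (f : Sym2 V → R) :
    ∑ e ∈ G.incidenceFinset x, f e = ∑ y ∈ G.neighborFinset x, f s(x, y) := by
  refine (Finset.sum_nbij (fun y => s(x, y)) (fun y hy => ?_)
    (fun y _ z _ => Sym2.congr_right.1) (fun e he => ?_) fun _ _ => rfl).symm
  · simpa using hy
  · obtain ⟨he, y, rfl⟩ := (G.mem_incidenceFinset x e).1 he
    exact ⟨y, by simpa using he, rfl⟩

lemma sum_edgeFinset_mul_update_neg (f : V → R) (x : V) :
    ∑ e ∈ G.edgeFinset, (e.map (Function.update f x (-f x))).mul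
      = ∑ e ∈ G.edgeFinset, (e.map f).mul - 2 * f x * ∑ y ∈ G.neighborFinset x, f y := by
  set g := Function.update f x (-f x)
  have hincidence : ∑ e ∈ G.edgeFinset, ((e.map g).mul - (e.map f).mul)
      = ∑ e ∈ G.incidenceFinset x, ((e.map g).mul - (e.map f).mul) := by
    refine (Finset.sum_subset (G.incidenceFinset_subset x) fun e he hex => ?_).symm
    induction e with | _ y z
    have hyz : x ≠ y ∧ x ≠ z := by
      have hadj : G.Adj y z := by simpa using he
      simpa [SimpleGraph.mk'_mem_incidenceSet_iff, hadj] using hex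
    simp [g, hyz.1.symm, hyz.2.symm]
  have hneighbor : ∀ y ∈ G.neighborFinset x, g x * g y - f x * f y = -(2 * f x) * f y := by
    intro y hy
    have hyx : y ≠ x := (G.ne_of_adj (by simpa using hy)).symm
    simp only [g, Function.update_self, Function.update_of_ne hyx]
    ring
  rw [sub_eq_add_neg, ← sub_eq_iff_eq_add', ← Finset.sum_sub_distrib, hincidence,
    sum_incidenceFinset]
  simp only [Sym2.map_mk, Sym2.mul_mk]
  rw [Finset.sum_congr rfl hneighbor, ← Finset.mul_sum, neg_mul]

end EdgeSums

section Energy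

variable {L : ℕ}

lemma spin_flip (σ : Config L) (x : Site L) :
    spin (flip σ x) = Function.update (spin σ) x (-spin σ x) := by
  funext y
  obtain rfl | hy := eq_or_ne y x
  · simp [spin, flip]
  · simp [spin, flip, hy]

lemma flip_flip (σ : Config L) (x : Site L) : flip (flip σ x) x = σ := by
  simp [flip]

lemma flip_ne (σ : Config L) (x : Site L) : flip σ x ≠ σ :=
  Function.update_ne_self_iff.2 (neg_units_ne_self _)

lemma flip_comp (σ : Config L) (φ : hexTorus L ≃g hexTorus L) (x : Site L) :
    flip σ (φ x) ∘ φ = flip (σ ∘ φ) x :=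
  Function.update_comp_eq_of_injective _ φ.injective _ _

lemma flip_eq_update {σ : Config L} {x : Site L} {s : ℤˣ} (hx : σ x = -s) :
    flip σ x = Function.update σ x s := by
  rw [flip, hx, neg_neg]

lemma not_adj_inl_inl (u d : ZMod L × ZMod L) : ¬(hexTorus L).Adj (.inl u) (.inl d) := id

lemma not_adj_inr_inr (u d : ZMod L × ZMod L) : ¬(hexTorus L).Adj (.inr u) (.inr d) := id

lemma adj_inl_inr {u d : ZMod L × ZMod L} : (hexTorus L).Adj (.inl u) (.inr d) ↔
    d = u ∨ d = (u.1 - 1, u.2) ∨ d = (u.1, u.2 - 1) := Iff.rfl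

lemma adj_inr_inl {u d : ZMod L × ZMod L} : (hexTorus L).Adj (.inr d) (.inl u) ↔
    d = u ∨ d = (u.1 - 1, u.2) ∨ d = (u.1, u.2 - 1) := Iff.rfl

lemma spin_mul_le_one (σ : Config L) (x y : Site L) : spin σ x * spin σ y ≤ 1 := by
  rcases Int.units_eq_one_or (σ x) with hx | hx <;>
    rcases Int.units_eq_one_or (σ y) with hy | hy <;> simp [spin, hx, hy]

lemma adj_inl_below (a b : ZMod L) : (hexTorus L).Adj (.inl (a, b)) (.inr (a, b - 1)) :=
  .inr (.inr rfl)

lemma adj_inl_right (a b : ZMod L) : (hexTorus L).Adj (.inl (a, b)) (.inr (a, b)) := .inl rfl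

lemma adj_inl_left (a b : ZMod L) : (hexTorus L).Adj (.inl (a, b)) (.inr (a - 1, b)) :=
  .inr (.inl rfl)

lemma adj_inr_above (a b : ZMod L) : (hexTorus L).Adj (.inr (a, b)) (.inl (a, b + 1)) :=
  adj_inr_inl.2 (by simp)

lemma adj_inr_left (a b : ZMod L) : (hexTorus L).Adj (.inr (a, b)) (.inl (a, b)) := .inl rfl

lemma adj_inr_right (a b : ZMod L) : (hexTorus L).Adj (.inr (a, b)) (.inl (a + 1, b)) :=
  adj_inr_inl.2 (by simp)

variable [NeZero L]

lemma energy_comp (J h : ℝ) (σ : Config L) (φ : hexTorus L ≃g hexTorus L) :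
    energy J h (σ ∘ φ) = energy J h σ := by
  classical
  have hspin : spin (σ ∘ φ) = spin σ ∘ φ := rfl
  have hedges := sum_edgeFinset_comp φ fun e => (e.map (spin σ)).mul
  simp only [Sym2.map_map, ← hspin] at hedges
  rw [energy, energy, hedges]
  congr 2
  exact φ.toEquiv.sum_comp (spin σ)

open scoped Classical in
lemma energy_flip (J h : ℝ) (σ : Config L) (x : Site L) :
    energy J h (flip σ x)
      = energy J h σ + spin σ x * (J * ∑ y ∈ (hexTorus L).neighborFinset x, spin σ y + h) := by
  have hsum : ∑ y, spin (flip σ x) y = ∑ y, spin σ y - 2 * spin σ x := by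
    rw [spin_flip, Finset.sum_update_of_mem (Finset.mem_univ x),
      ← Finset.sum_sdiff (Finset.subset_univ {x}) (f := spin σ), Finset.sum_singleton]
    ring
  simp only [energy, hsum]
  rw [spin_flip, sum_edgeFinset_mul_update_neg]
  ring

open scoped Classical in
lemma hexTorus_isRegularOfDegree (hL : 2 ≤ L) : (hexTorus L).IsRegularOfDegree 3 := by
  have : Fact (1 < L) := ⟨hL⟩
  intro x
  rw [← SimpleGraph.card_neighborFinset_eq_degree, Finset.card_eq_three]
  rcases x with ⟨a, b⟩ | ⟨a, b⟩
  · refine ⟨.inr (a, b), .inr (a - 1, b), .inr (a, b - 1), by simp [eq_sub_iff_add_eq],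
      by simp [eq_sub_iff_add_eq], by simp, ?_⟩
    ext (y | y)
    · simp [not_adj_inl_inl]
    · simp [adj_inl_inr]
  · refine ⟨.inl (a, b), .inl (a + 1, b), .inl (a, b + 1), by simp, by simp, by simp, ?_⟩
    ext (⟨c, d⟩ | y)
    · simp only [SimpleGraph.mem_neighborFinset, adj_inr_inl, Finset.mem_insert,
        Finset.mem_singleton, Sum.inl.injEq, Prod.mk.injEq]
      grind
    · simp [not_adj_inr_inr]

lemma energy_update_le (hL : 2 ≤ L) {J : ℝ} (hJ : 0 ≤ J) (h : ℝ) {σ : Config L} {x : Site L}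
    {s : ℤˣ} (hx : σ x = -s) (T : Finset (Site L))
    (hT : ∀ y ∈ T, (hexTorus L).Adj x y ∧ σ y = s) :
    energy J h (Function.update σ x s)
      ≤ energy J h σ + (3 - 2 * T.card) * J - ((s : ℤ) : ℝ) * h := by
  classical
  have hspin : spin σ x = -((s : ℤ) : ℝ) := by simp [spin, hx]
  have hTN : T ⊆ (hexTorus L).neighborFinset x := fun y hy => by simpa using (hT y hy).1
  have hdisagree : ∑ y ∈ T, spin σ x * spin σ y = -(T.card : ℝ) := by
    rw [Finset.sum_congr rfl fun y hy => show spin σ x * spin σ y = -1 by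
      rcases Int.units_eq_one_or s with hs | hs <;> simp [spin, hx, (hT y hy).2, hs]]
    simp
  have hrest : ∑ y ∈ (hexTorus L).neighborFinset x \ T, spin σ x * spin σ y
      ≤ 3 - (T.card : ℝ) := by
    refine (Finset.sum_le_card_nsmul _ _ 1 fun y _ => spin_mul_le_one σ x y).trans_eq ?_
    rw [nsmul_one, Finset.cast_card_sdiff hTN, SimpleGraph.card_neighborFinset_eq_degree,
      hexTorus_isRegularOfDegree hL x, Nat.cast_ofNat]
  have hsum : spin σ x * ∑ y ∈ (hexTorus L).neighborFinset x, spin σ y ≤ 3 - 2 * T.card := by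
    rw [Finset.mul_sum, ← Finset.sum_sdiff hTN, hdisagree]
    linarith
  rw [← flip_eq_update hx, energy_flip]
  linear_combination J * hsum + h * hspin

lemma energy_update_le_of_adj (hL : 2 ≤ L) {J : ℝ} (hJ : 0 ≤ J) (h : ℝ) {σ : Config L}
    {x y : Site L} {s : ℤˣ} (hx : σ x = -s) (hxy : (hexTorus L).Adj x y) (hy : σ y = s) :
    energy J h (Function.update σ x s) ≤ energy J h σ + J - ((s : ℤ) : ℝ) * h := by
  have := energy_update_le hL hJ h hx {y} (by simp [hxy, hy])
  norm_num at this
  linarith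

lemma energy_update_le_of_adj_adj (hL : 2 ≤ L) {J : ℝ} (hJ : 0 ≤ J) (h : ℝ) {σ : Config L}
    {x y z : Site L} {s : ℤˣ} (hx : σ x = -s) (hyz : y ≠ z) (hxy : (hexTorus L).Adj x y)
    (hy : σ y = s) (hxz : (hexTorus L).Adj x z) (hz : σ z = s) :
    energy J h (Function.update σ x s) ≤ energy J h σ - J - ((s : ℤ) : ℝ) * h := by
  have := energy_update_le hL hJ h hx {y, z} (by simp [hxy, hy, hxz, hz])
  rw [Finset.card_pair hyz] at this
  norm_num at this
  linarith

end Energy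

/-! ### Paths of spin flips -/

section Reach

variable {L : ℕ} [NeZero L]

/-- `η` is obtained from `σ` by a single spin flip, and both configurations have energy at most
`c`. -/
def FlipBelow (J h c : ℝ) (σ η : Config L) : Prop :=
  (∃ x, flip σ x = η) ∧ energy J h σ ≤ c ∧ energy J h η ≤ c

/-- `η` can be reached from `σ` along a path of spin flips of height at most `c`. The constant path
is allowed whatever the energy of `σ`. -/
def Reach (J h c : ℝ) : Config L → Config L → Prop := Relation.ReflTransGen (FlipBelow J h c)

/-- `η` can be reached from `σ` along a path of height at most `c`, and has energy at most `e`: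
the latter bounds the height of the next step. -/
def ReachWithin (J h c e : ℝ) (σ η : Config L) : Prop := Reach J h c σ η ∧ energy J h η ≤ e

variable {J h c c' e : ℝ} {σ η : Config L}

lemma Reach.mono (H : Reach J h c σ η) (hc : c ≤ c') : Reach J h c' σ η :=
  Relation.ReflTransGen.mono (fun _ _ H' => ⟨H'.1, H'.2.1.trans hc, H'.2.2.trans hc⟩) _ _ H

lemma Reach.comp (H : Reach J h c σ η) (φ : hexTorus L ≃g hexTorus L) :
    Reach J h c (σ ∘ φ) (η ∘ φ) := by
  refine Relation.ReflTransGen.lift (fun ζ : Config L => ζ ∘ φ) ?_ _ _ H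
  rintro ζ ξ ⟨⟨x, hx⟩, hζ, hξ⟩
  refine ⟨⟨φ.symm x, ?_⟩, by rwa [energy_comp], by rwa [energy_comp]⟩
  rw [← flip_comp, φ.apply_symm_apply, hx]

lemma reachWithin_refl (c : ℝ) (σ : Config L) : ReachWithin J h c (energy J h σ) σ σ :=
  ⟨.refl, le_rfl⟩

namespace ReachWithin

lemma comp (H : ReachWithin J h c e σ η) (φ : hexTorus L ≃g hexTorus L) :
    ReachWithin J h c e (σ ∘ φ) (η ∘ φ) :=
  ⟨H.1.comp φ, (energy_comp J h η φ).trans_le H.2⟩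

lemma update {x : Site L} {s : ℤˣ} (H : ReachWithin J h c e σ η) (hx : η x = -s) {e' : ℝ}
    (he' : energy J h (Function.update η x s) ≤ energy J h η + e') (he : e ≤ c)
    (hc : e + e' ≤ c) : ReachWithin J h c (e + e') σ (Function.update η x s) := by
  have hupdate : energy J h (Function.update η x s) ≤ e + e' := he'.trans (by grw [H.2])
  exact ⟨H.1.tail ⟨⟨x, flip_eq_update hx⟩, H.2.trans he, hupdate.trans hc⟩, hupdate⟩

lemma update_of_adj (hL : 2 ≤ L) (hJ : 0 ≤ J) {x y : Site L} {s : ℤˣ}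
    (H : ReachWithin J h c e σ η) (hx : η x = -s) (hxy : (hexTorus L).Adj x y) (hy : η y = s)
    (he : e ≤ c) (hc : e + (J - ((s : ℤ) : ℝ) * h) ≤ c) :
    ReachWithin J h c (e + (J - ((s : ℤ) : ℝ) * h)) σ (Function.update η x s) :=
  H.update hx ((energy_update_le_of_adj hL hJ h hx hxy hy).trans_eq (add_sub_assoc _ _ _)) he hc

lemma update_of_adj_adj (hL : 2 ≤ L) (hJ : 0 ≤ J) {x y z : Site L} {s : ℤˣ}
    (H : ReachWithin J h c e σ η) (hx : η x = -s) (hyz : y ≠ z) (hxy : (hexTorus L).Adj x y)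
    (hy : η y = s) (hxz : (hexTorus L).Adj x z) (hz : η z = s) (he : e ≤ c)
    (hc : e + (-J - ((s : ℤ) : ℝ) * h) ≤ c) :
    ReachWithin J h c (e + (-J - ((s : ℤ) : ℝ) * h)) σ (Function.update η x s) :=
  H.update hx ((energy_update_le_of_adj_adj hL hJ h hx hyz hxy hy hxz hz).trans_eq (by ring)) he hc

end ReachWithin

end Reach

section Trapezoid

variable {L : ℕ}

open scoped Classical in
/-- The configuration obtained from `σ` by setting all spins of `S` to `s`. -/
noncomputable def paint (σ : Config L) (S : Set (Site L)) (s : ℤˣ) : Config L :=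
  fun x => if x ∈ S then s else σ x

/-- The trapezoid formed by the upper-pointing faces of the cells `(-i, b)`, `p ≤ i < q`, and the
lower-pointing faces between them: a segment of the row `b`, listed from right to left. -/
def trapezoid (b : ZMod L) (p q : ℕ) : Set (Site L) :=
  (fun i : ℕ => .inl (-i, b)) '' Set.Ico p q ∪ (fun i : ℕ => .inr (-i, b)) '' Set.Ioo p q

variable {σ : Config L} {S : Set (Site L)} {s : ℤˣ} {x : Site L}

lemma paint_of_mem (hx : x ∈ S) : paint σ S s x = s := if_pos hx

lemma paint_of_notMem (hx : x ∉ S) : paint σ S s x = σ x := if_neg hx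

lemma paint_of_eq (hx : σ x = s) : paint σ S s x = s := by
  unfold paint
  split_ifs <;> trivial

lemma paint_empty : paint σ ∅ s = σ := funext fun _ => paint_of_notMem (Set.notMem_empty _)

lemma paint_insert : paint σ (insert x S) s = Function.update (paint σ S s) x s := by
  funext y
  obtain rfl | hy := eq_or_ne y x
  · rw [paint_of_mem (Set.mem_insert _ _), Function.update_self]
  · rw [Function.update_of_ne hy]
    by_cases hS : y ∈ S
    · rw [paint_of_mem hS, paint_of_mem (Set.mem_insert_of_mem _ hS)]
    · rw [paint_of_notMem hS, paint_of_notMem (by simp [hy, hS])]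

lemma le_paint_one : σ ≤ paint σ S 1 := by
  intro x
  by_cases hx : x ∈ S
  · rw [paint_of_mem hx]
    exact (show ∀ s : ℤˣ, s ≤ 1 by decide) (σ x)
  · rw [paint_of_notMem hx]

lemma lt_paint_one (hx : x ∈ S) (hσ : σ x = -1) : σ < paint σ S 1 := by
  refine Pi.lt_def.2 ⟨le_paint_one, x, ?_⟩
  rw [paint_of_mem hx, hσ]
  decide

variable {b : ZMod L} {p q : ℕ}

lemma natCast_zmod_ne {i j : ℕ} (hij : i < j) (hji : j < i + L) : (i : ZMod L) ≠ j := by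
  rw [Ne, ZMod.natCast_eq_natCast_iff, Nat.modEq_iff_dvd' hij.le]
  intro hdvd
  have := Nat.le_of_dvd (by omega) hdvd
  omega

lemma inl_mem_trapezoid {i : ℕ} (hpi : p ≤ i) (hiq : i < q) :
    .inl (-i, b) ∈ trapezoid b p q :=
  Or.inl ⟨i, ⟨hpi, hiq⟩, rfl⟩

lemma inr_mem_trapezoid {i : ℕ} (hpi : p < i) (hiq : i < q) :
    .inr (-i, b) ∈ trapezoid b p q :=
  Or.inr ⟨i, ⟨hpi, hiq⟩, rfl⟩

lemma paint_trapezoid_inl (hq : q < p + L) :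
    paint σ (trapezoid b p q) s (.inl (-q, b)) = σ (.inl (-q, b)) := by
  refine paint_of_notMem ?_
  rintro (⟨i, ⟨hpi, hiq⟩, hi⟩ | ⟨i, -, hi⟩)
  · exact natCast_zmod_ne (L := L) hiq (by omega) (by simpa using hi)
  · simp at hi

lemma paint_trapezoid_inr {i : ℕ} (hqi : q ≤ i) (hi : i ≤ p + L) :
    paint σ (trapezoid b p q) s (.inr (-i, b)) = σ (.inr (-i, b)) := by
  refine paint_of_notMem ?_
  rintro (⟨j, -, hj⟩ | ⟨j, ⟨hpj, hjq⟩, hj⟩)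
  · simp at hj
  · exact natCast_zmod_ne (L := L) (hjq.trans_le hqi) (by omega) (by simpa using hj)

lemma paint_trapezoid_inl_of_ne {a b' : ZMod L} (hb : b' ≠ b) :
    paint σ (trapezoid b p q) s (.inl (a, b')) = σ (.inl (a, b')) :=
  paint_of_notMem (by simp [trapezoid, hb.symm])

lemma paint_trapezoid_inr_of_ne {a b' : ZMod L} (hb : b' ≠ b) :
    paint σ (trapezoid b p q) s (.inr (a, b')) = σ (.inr (a, b')) :=
  paint_of_notMem (by simp [trapezoid, hb.symm])

lemma trapezoid_succ_self : trapezoid b p (p + 1) = {.inl (-p, b)} := by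
  have hIoo : Set.Ioo p (p + 1) = ∅ := by ext; simp
  have hIco : Set.Ico p (p + 1) = {p} := by ext; simp; omega
  simp [trapezoid, hIoo, hIco]

lemma trapezoid_succ (hpq : p < q) :
    trapezoid b p (q + 1) = insert (.inl (-q, b)) (insert (.inr (-q, b)) (trapezoid b p q)) := by
  have hIco : Set.Ico p (q + 1) = insert q (Set.Ico p q) := by ext; simp; omega
  have hIoo : Set.Ioo p (q + 1) = insert q (Set.Ioo p q) := by ext; simp; omega
  rw [Set.insert_comm]
  simp only [trapezoid, hIco, hIoo, Set.image_insert_eq, Set.insert_union, Set.union_insert]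

lemma trapezoid_mono {p' q' : ℕ} (hp : p' ≤ p) (hq : q ≤ q') :
    trapezoid b p q ⊆ trapezoid b p' q' :=
  Set.union_subset_union (Set.image_mono (Set.Ico_subset_Ico hp hq))
    (Set.image_mono (Set.Ioo_subset_Ioo hp hq))

lemma paint_trapezoid_succ (hpq : p < q) :
    paint σ (trapezoid b p (q + 1)) s = Function.update
      (Function.update (paint σ (trapezoid b p q) s) (.inr (-q, b)) s) (.inl (-q, b)) s := by
  rw [trapezoid_succ hpq, paint_insert, paint_insert]

lemma paint_trapezoid_succ_self :
    paint σ (trapezoid b p (p + 1)) s = Function.update σ (.inl (-p, b)) s := by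
  rw [trapezoid_succ_self, ← insert_empty_eq, paint_insert, paint_empty]

lemma adj_inr_right_succ (i : ℕ) (b : ZMod L) :
    (hexTorus L).Adj (.inr (-(i + 1 : ℕ), b)) (.inl (-i, b)) := by
  simpa using adj_inr_right (-(i + 1 : ℕ) : ZMod L) b

lemma adj_inl_left_succ (i : ℕ) (b : ZMod L) :
    (hexTorus L).Adj (.inl (-i, b)) (.inr (-(i + 1 : ℕ), b)) :=
  (adj_inr_right_succ i b).symm

end Trapezoid

/-! ### Sides of the plus region of a trap -/

section Sides

variable {L : ℕ} [NeZero L] {J h c e : ℝ} {σ η : Config L} {b : ZMod L} {p q : ℕ}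

lemma ReachWithin.fill_trapezoid (hL : 2 ≤ L) (hh : 0 < h) (hhJ : h < J)
    (H : ReachWithin J h c e σ η) (hpq : p < q) (hq : q ≤ p + L)
    (hη : ∀ x ∈ trapezoid b p q, η x = -1)
    (hbelow : ∀ i, p ≤ i → i < q → η (.inr (-i, b - 1)) = 1) (hc : e + (2 * J - 2 * h) ≤ c) :
    ReachWithin J h c (e + (J - (2 * (q - p) - 1) * h)) σ (paint η (trapezoid b p q) 1) := by
  have : Fact (1 < L) := ⟨hL⟩
  have hJ : 0 ≤ J := (hh.trans hhJ).le
  induction q, hpq using Nat.le_induction with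
  | base =>
    have hbase := H.update_of_adj hL hJ (hη _ (inl_mem_trapezoid le_rfl (Nat.lt_succ_self p)))
      (adj_inl_below _ _) (hbelow p le_rfl (by omega)) (by linarith) (by push_cast; linarith)
    rw [paint_trapezoid_succ_self]
    convert hbase using 1
    push_cast
    ring
  | succ q hpq ih =>
    obtain ⟨q, rfl⟩ : ∃ m, q = m + 1 := ⟨q - 1, by omega⟩
    have hpq' : (p : ℝ) ≤ q := by exact_mod_cast Nat.le_of_lt_succ hpq
    have hfilled := ih (by omega) (fun x hx => hη x (trapezoid_mono le_rfl (Nat.le_succ _) hx))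
      fun i hpi hiq => hbelow i hpi (by omega)
    have hdown := hfilled.update_of_adj hL hJ
      ((paint_trapezoid_inr le_rfl (by omega)).trans (hη _ (inr_mem_trapezoid hpq (by omega))))
      (adj_inr_right_succ q b) (paint_of_mem (inl_mem_trapezoid (by omega) (by omega)))
      (by push_cast; nlinarith) (by push_cast; nlinarith)
    rw [paint_trapezoid_succ hpq]
    convert hdown.update_of_adj_adj (x := .inl (-(q + 1 : ℕ), b)) hL hJ
      (by rw [Function.update_of_ne (by simp), paint_trapezoid_inl (by omega),
            hη _ (inl_mem_trapezoid (by omega) (by omega))])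
      (by simp [eq_sub_iff_add_eq]) (adj_inl_right _ _) (Function.update_self _ _ _)
      (adj_inl_below _ _)
      (by rw [Function.update_of_ne (by simp), paint_trapezoid_inr_of_ne (by simp),
            hbelow _ (by omega) (by omega)])
      (by push_cast; nlinarith) (by push_cast; nlinarith) using 1
    push_cast
    ring

lemma ReachWithin.empty_inr (hL : 2 ≤ L) (hh : 0 < h) (hhJ : h < J)
    (H : ReachWithin J h c e σ (paint η (trapezoid b p q) (-1))) (hpq : p < q) (hq : q < p + L)
    (hη : η (.inr (-q, b)) = 1) (habove : η (.inl (-q, b + 1)) = -1) (hec : e ≤ c) :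
    ReachWithin J h c (e - J + h) σ
      (Function.update (paint η (trapezoid b p q) (-1)) (.inr (-q, b)) (-1)) := by
  have : Fact (1 < L) := ⟨hL⟩
  obtain ⟨q, rfl⟩ : ∃ m, q = m + 1 := ⟨q - 1, by omega⟩
  convert H.update_of_adj_adj hL (hh.trans hhJ).le ((paint_trapezoid_inr le_rfl hq.le).trans hη)
    (by simp) (adj_inr_right_succ q b) (paint_of_mem (inl_mem_trapezoid (by omega) (by omega)))
    (adj_inr_above _ _) ((paint_trapezoid_inl_of_ne (by simp)).trans habove) hec
    (by push_cast; linarith) using 1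
  push_cast
  ring

lemma ReachWithin.empty_trapezoid (hL : 2 ≤ L) (hh : 0 < h) (hhJ : h < J)
    (H : ReachWithin J h c e σ η) (hpq : p < q) (hq : q ≤ p + L)
    (hη : ∀ x ∈ trapezoid b p q, η x = 1) (hright : η (.inr (-p, b)) = -1)
    (habove : ∀ i, p < i → i < q → η (.inl (-i, b + 1)) = -1)
    (hc : e + (J + (2 * (q - p) - 1) * h) ≤ c) :
    ReachWithin J h c (e + (J + (2 * (q - p) - 1) * h)) σ (paint η (trapezoid b p q) (-1)) := by
  have hJ : 0 ≤ J := (hh.trans hhJ).le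
  induction q, hpq using Nat.le_induction with
  | base =>
    push_cast at hc
    have hbase := H.update_of_adj hL hJ (hη _ (inl_mem_trapezoid le_rfl (Nat.lt_succ_self p)))
      (adj_inl_right _ _) hright (by linarith) (by push_cast; linarith)
    rw [paint_trapezoid_succ_self]
    convert hbase using 1
    push_cast
    ring
  | succ q hpq ih =>
    push_cast at hc
    have hemptied := ih (by omega) (fun x hx => hη x (trapezoid_mono le_rfl (Nat.le_succ _) hx))
      (fun i hpi hiq => habove i hpi (by omega)) (by linarith)
    have hdown := hemptied.empty_inr hL hh hhJ hpq (by omega)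
      (hη _ (inr_mem_trapezoid hpq (by omega))) (habove _ hpq (by omega)) (by linarith)
    rw [paint_trapezoid_succ hpq]
    convert hdown.update_of_adj (x := .inl (-q, b)) hL hJ
      (by rw [Function.update_of_ne (by simp), paint_trapezoid_inl (by omega),
            hη _ (inl_mem_trapezoid (by omega) (by omega)), neg_neg])
      (adj_inl_right _ _) (Function.update_self _ _ _) (by linarith) (by push_cast; linarith)
      using 1
    push_cast
    ring

lemma ReachWithin.empty_trapezoid_of_left (hL : 2 ≤ L) (hh : 0 < h) (hhJ : h < J)
    (H : ReachWithin J h c e σ η) (hpq : p ≤ q) (hq : q < p + L)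
    (hη : ∀ x ∈ trapezoid b p (q + 1), η x = 1) (hright : η (.inr (-p, b)) = -1)
    (hleft : η (.inr (-(q + 1 : ℕ), b)) = -1)
    (habove : ∀ i, p < i → i ≤ q → η (.inl (-i, b + 1)) = -1)
    (hc : e + (J + (2 * (q - p) - 1) * h) ≤ c) :
    ReachWithin J h c (e - J + (2 * (q - p) + 1) * h) σ
      (paint η (trapezoid b p (q + 1)) (-1)) := by
  have : Fact (1 < L) := ⟨hL⟩
  have hJ : 0 ≤ J := (hh.trans hhJ).le
  have hne : (.inr (-(q + 1 : ℕ), b) : Site L) ≠ .inr (-q, b) := by simp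
  obtain rfl | hpq := hpq.eq_or_lt
  · rw [paint_trapezoid_succ_self]
    convert H.update_of_adj_adj hL hJ (hη _ (inl_mem_trapezoid le_rfl (Nat.lt_succ_self p)))
      hne.symm (adj_inl_right _ _) hright (adj_inl_left_succ p b) hleft (by linarith)
      (by push_cast; linarith) using 1
    push_cast
    ring
  · have hdown := (H.empty_trapezoid hL hh hhJ hpq (by omega)
      (fun x hx => hη x (trapezoid_mono le_rfl (Nat.le_succ _) hx)) hright
      (fun i hpi hiq => habove i hpi hiq.le) hc).empty_inr hL hh hhJ hpq (by omega)
      (hη _ (inr_mem_trapezoid hpq (by omega))) (habove _ hpq le_rfl) hc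
    rw [paint_trapezoid_succ hpq]
    convert hdown.update_of_adj_adj (x := .inl (-q, b)) hL hJ
      (by rw [Function.update_of_ne (by simp), paint_trapezoid_inl (by omega),
            hη _ (inl_mem_trapezoid (by omega) (by omega)), neg_neg])
      hne.symm (adj_inl_right _ _) (Function.update_self _ _ _) (adj_inl_left_succ q b)
      (by rw [Function.update_of_ne hne, paint_trapezoid_inr (by omega) (by omega), hleft])
      (by linarith) (by push_cast; linarith) using 1
    push_cast
    ring

lemma reachWithin_fill_row (hL : 2 ≤ L) (hh : 0 < h) (hhJ : h < J)
    (hrow : ∀ a, σ (.inl (a, b)) = -1 ∧ σ (.inr (a, b)) = -1)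
    (hbelow : ∀ a, σ (.inr (a, b - 1)) = 1) :
    ∃ η, ReachWithin J h (energy J h σ + 2 * J) (energy J h σ - 2 * L * h) σ η := by
  have hfilled := (reachWithin_refl (energy J h σ + 2 * J) σ).fill_trapezoid hL hh hhJ
    (b := b) (NeZero.pos L) (by simp)
    (by rintro x (⟨i, -, rfl⟩ | ⟨i, -, rfl⟩) <;> simp [hrow]) (fun i _ _ => hbelow _) (by linarith)
  obtain ⟨K, rfl⟩ : ∃ K, L = K + 1 := ⟨L - 1, by omega⟩
  have : Fact (1 < K + 1) := ⟨hL⟩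
  have hself : (-(K + 1 : ℕ) : ZMod (K + 1)) = -(0 : ℕ) := by simp
  have hclosed := hfilled.update_of_adj_adj (x := .inr (-(K + 1 : ℕ), b))
    (y := .inl (-K, b)) (z := .inl (-(K + 1 : ℕ), b)) hL (hh.trans hhJ).le
    ((paint_trapezoid_inr le_rfl (by omega)).trans (hrow _).2)
    (by simpa using natCast_zmod_ne (L := K + 1) (Nat.lt_succ_self K) (by omega))
    (adj_inr_right_succ K b) (paint_of_mem (inl_mem_trapezoid (by omega) (by omega)))
    (adj_inr_left _ _)
    (paint_of_mem (by rw [hself]; exact inl_mem_trapezoid le_rfl (by omega)))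
    (by push_cast; nlinarith) (by push_cast; nlinarith)
  exact ⟨_, by convert hclosed using 1; push_cast; ring⟩

end Sides

section Automorphisms

variable {L : ℕ}

/-- Translation of the torus by `v`. Together with `rotation`, the translations act transitively on
the ordered pairs of neighbours. -/
def translation (v : ZMod L × ZMod L) : hexTorus L ≃g hexTorus L where
  toEquiv := Equiv.sumCongr (Equiv.addRight v) (Equiv.addRight v)
  map_rel_iff' := by
    obtain ⟨p, q⟩ := v
    rintro (⟨a, b⟩ | ⟨a, b⟩) (⟨c, d⟩ | ⟨c, d⟩) <;>
      simp [adj_inl_inr, adj_inr_inl, not_adj_inl_inl, not_adj_inr_inr, -Prod.mk_add_mk,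
        Prod.ext_iff] <;> grind

/-- The rotation by 60 degrees around the vertex `(0, 0)` of the triangular lattice. -/
def rotation : hexTorus L ≃g hexTorus L where
  toFun
    | .inl (a, b) => .inr (-b - 1, a + b)
    | .inr (a, b) => .inl (-b - 1, a + b + 1)
  invFun
    | .inl (a, b) => .inr (a + b, -a - 1)
    | .inr (a, b) => .inl (a + b + 1, -a - 1)
  left_inv := by rintro (⟨a, b⟩ | ⟨a, b⟩) <;> simp; ring
  right_inv := by rintro (⟨a, b⟩ | ⟨a, b⟩) <;> simp; ring
  map_rel_iff' := by
    rintro (⟨a, b⟩ | ⟨a, b⟩) (⟨c, d⟩ | ⟨c, d⟩) <;>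
      simp [adj_inl_inr, adj_inr_inl, not_adj_inl_inl, not_adj_inr_inr] <;> grind

/-- The reflection fixing the vertex `(0, 0)` and the direction of the second axis. It exchanges the
two sides of the plus region that meet at a corner `(0, 0)`. -/
def reflection : hexTorus L ≃g hexTorus L where
  toFun
    | .inl (a, b) => .inr (-a - 1, a + b)
    | .inr (a, b) => .inl (-a - 1, a + b + 1)
  invFun
    | .inl (a, b) => .inr (-a - 1, a + b)
    | .inr (a, b) => .inl (-a - 1, a + b + 1)
  left_inv := by rintro (⟨a, b⟩ | ⟨a, b⟩) <;> simp; ring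
  right_inv := by rintro (⟨a, b⟩ | ⟨a, b⟩) <;> simp; ring
  map_rel_iff' := by
    rintro (⟨a, b⟩ | ⟨a, b⟩) (⟨c, d⟩ | ⟨c, d⟩) <;>
      simp [adj_inl_inr, adj_inr_inl, not_adj_inl_inl, not_adj_inr_inr] <;> grind

@[simp]
lemma translation_inl (v u : ZMod L × ZMod L) : translation v (.inl u) = .inl (u + v) := rfl

@[simp]
lemma translation_inr (v u : ZMod L × ZMod L) : translation v (.inr u) = .inr (u + v) := rfl

@[simp]
lemma rotation_inl (a b : ZMod L) : rotation (.inl (a, b)) = .inr (-b - 1, a + b) := rfl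

@[simp]
lemma rotation_inr (a b : ZMod L) : rotation (.inr (a, b)) = .inl (-b - 1, a + b + 1) := rfl

@[simp]
lemma reflection_inl (a b : ZMod L) : reflection (.inl (a, b)) = .inr (-a - 1, a + b) := rfl

@[simp]
lemma reflection_inr (a b : ZMod L) : reflection (.inr (a, b)) = .inl (-a - 1, a + b + 1) := rfl

lemma exists_iso_arc {x y : Site L} (hxy : (hexTorus L).Adj x y) :
    ∃ φ : hexTorus L ≃g hexTorus L, φ (.inr (0, -1)) = x ∧ φ (.inl (0, 0)) = y := by
  let rotate (k : ℕ) (v : ZMod L × ZMod L) : hexTorus L ≃g hexTorus L :=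
    translation v * rotation ^ k
  rcases x with ⟨a, b⟩ | x <;> rcases y with ⟨c, d⟩ | y
  · exact absurd hxy (not_adj_inl_inl _ _)
  · obtain rfl | rfl | rfl := adj_inl_inr.1 hxy
    · exact ⟨rotate 5 (a, b + 1), by simp [rotate, pow_succ], by simp [rotate, pow_succ]⟩
    · exact ⟨rotate 1 (a, b), by simp [rotate], by simp [rotate, neg_add_eq_sub]⟩
    · exact ⟨rotate 3 (a + 1, b), by simp [rotate, pow_succ, neg_add_eq_sub],
        by simp [rotate, pow_succ, neg_add_eq_sub]⟩
  · obtain rfl | rfl | rfl := adj_inr_inl.1 hxy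
    · exact ⟨rotate 2 (c + 1, d), by simp [rotate, pow_succ], by simp [rotate, pow_succ]⟩
    · exact ⟨rotate 4 (c, d + 1), by simp [rotate, pow_succ, neg_add_eq_sub],
        by simp [rotate, pow_succ, neg_add_eq_sub]⟩
    · exact ⟨rotate 0 (c, d), by simp [rotate, neg_add_eq_sub], by simp [rotate]⟩
  · exact absurd hxy (not_adj_inr_inr _ _)

lemma reachable_inl_add (a b : ZMod L) (i j : ℕ) :
    (hexTorus L).Reachable (.inl (a, b)) (.inl (a + i, b + j)) := by
  have hfst : ∀ a, (hexTorus L).Reachable (.inl (a, b)) (.inl (a + 1, b)) := fun a =>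
    (adj_inl_right a b).reachable.trans (adj_inr_right a b).reachable
  have hsnd : ∀ a b, (hexTorus L).Reachable (.inl (a, b)) (.inl (a, b + 1)) := fun a b =>
    (adj_inl_right a b).reachable.trans (adj_inr_above a b).reachable
  induction j with
  | zero =>
    induction i with
    | zero => simp
    | succ i ih => simpa [add_assoc] using ih.trans (by simpa [add_assoc] using hfst (a + i))
  | succ j ih => simpa [add_assoc] using ih.trans (hsnd (a + i) (b + j))

lemma hexTorus_preconnected (L : ℕ) [NeZero L] : (hexTorus L).Preconnected := by
  have hinl : ∀ v, (hexTorus L).Reachable (.inl (0, 0)) (.inl v) := by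
    rintro ⟨a, b⟩
    simpa using reachable_inl_add (0 : ZMod L) 0 a.val b.val
  have hzero : ∀ x, (hexTorus L).Reachable (.inl (0, 0)) x := by
    rintro (v | ⟨a, b⟩)
    · exact hinl v
    · exact (hinl (a, b)).trans (adj_inl_right a b).reachable
  exact fun x y => (hzero x).symm.trans (hzero y)

end Automorphisms

section Traps

variable {L : ℕ} [NeZero L]

/-- `η` is preferred to `σ`: it has lower energy, ties being broken by the pointwise order. -/
def Better (J h : ℝ) (η σ : Config L) : Prop :=
  energy J h η < energy J h σ ∨ energy J h η ≤ energy J h σ ∧ σ < η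

/-- No configuration preferred to `σ` can be reached from `σ` by climbing at most `2 * J`. -/
def IsTrap (J h : ℝ) (σ : Config L) : Prop :=
  ∀ η, Reach J h (energy J h σ + 2 * J) σ η → ¬Better J h η σ

/-- A vertical edge crossing the boundary between the rows `b - 1` and `b` of cells, with a plus
spin below and a minus spin above. -/
def IsTop (σ : Config L) (a b : ZMod L) : Prop := σ (.inr (a, b - 1)) = 1 ∧ σ (.inl (a, b)) = -1

/-- The plus spins below the row `0` have a side of length `n` at the cells `(-i, 0)`,
`1 ≤ i ≤ n`. -/
structure IsSide (σ : Config L) (n : ℕ) : Prop where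
  one_le : 1 ≤ n
  lt_card : n < L
  isTop : ∀ i, 1 ≤ i → i ≤ n → IsTop σ (-i) 0
  right : σ (.inr (0, -1)) = -1
  left : σ (.inr (-(n + 1 : ℕ), -1)) = -1

variable {J h : ℝ} {σ η : Config L}

lemma wellFounded_better (J h : ℝ) : WellFounded (Better (L := L) J h) := by
  have : IsTrans (Config L) (Better J h) := ⟨by
    rintro ρ η σ (hρη | ⟨hρη, hηρ⟩) (hησ | ⟨hησ, hση⟩)
    exacts [.inl (hρη.trans hησ), .inl (hρη.trans_le hησ), .inl (hρη.trans_lt hησ),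
      .inr ⟨hρη.trans hησ, hση.trans hηρ⟩]⟩
  have : Std.Irrefl (Better (L := L) J h) := ⟨fun σ H => by simp [Better] at H⟩
  exact Finite.wellFounded_of_trans_of_irrefl _

namespace IsTrap

lemma comp (hσ : IsTrap J h σ) (φ : hexTorus L ≃g hexTorus L) : IsTrap J h (σ ∘ φ) := by
  intro η hη hbetter
  have hφ : ∀ ζ : Config L, (ζ ∘ φ) ∘ φ.symm = ζ := fun ζ => by ext; simp
  refine hσ (η ∘ φ.symm) ?_ ?_
  · have := hη.comp φ.symm
    rwa [hφ, energy_comp] at this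
  · rw [Better, energy_comp] at hbetter ⊢
    refine hbetter.imp_right fun ⟨henergy, hlt⟩ => ⟨henergy, ?_⟩
    obtain ⟨hle, x, hx⟩ := Pi.lt_def.1 hlt
    exact Pi.lt_def.2 ⟨fun y => by simpa using hle (φ.symm y), φ x, by simpa using hx⟩

variable {d : ℝ}

lemma nonneg_of_reachWithin (hσ : IsTrap J h σ)
    (H : ReachWithin J h (energy J h σ + 2 * J) (energy J h σ + d) σ η) : 0 ≤ d := by
  by_contra! hd
  exact hσ η H.1 (.inl (by linarith [H.2]))

lemma pos_of_reachWithin (hσ : IsTrap J h σ)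
    (H : ReachWithin J h (energy J h σ + 2 * J) (energy J h σ + d) σ η) (hlt : σ < η) :
    0 < d := by
  by_contra! hd
  exact hσ η H.1 (.inr ⟨by linarith [H.2], hlt⟩)

variable (hσ : IsTrap J h σ) (hL : 2 ≤ L) (hh : 0 < h) (hhJ : h < J)
include hσ hL hh hhJ

lemma eq_of_adj_of_ne {x y z : Site L} (hxy : (hexTorus L).Adj x y)
    (hxz : (hexTorus L).Adj x z) (hyz : y ≠ z) (hne : σ x ≠ σ y) : σ z = σ x := by
  by_contra hne'
  have hzx : σ z = σ y := by
    rw [Int.units_ne_iff_eq_neg.1 hne', Int.units_ne_iff_eq_neg.1 hne, neg_neg]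
  have hflip := (reachWithin_refl (energy J h σ + 2 * J) σ).update_of_adj_adj hL
    (hh.trans hhJ).le (Int.units_ne_iff_eq_neg.1 hne) hyz hxy rfl hxz hzx (by linarith)
    (by rcases Int.units_eq_one_or (σ y) with hy | hy <;> simp [hy] <;> linarith)
  have := hσ.nonneg_of_reachWithin hflip
  rcases Int.units_eq_one_or (σ y) with hy | hy <;> simp [hy] at this <;> linarith

lemma eq_neg_one_of_adj {x y z w : Site L} (hxy : (hexTorus L).Adj x y) (hx : σ x = -1)
    (hy : σ y = -1) (hxz : (hexTorus L).Adj x z) (hz : σ z = 1) (hyw : (hexTorus L).Adj y w) :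
    σ w = -1 := by
  by_contra hw
  have hw1 : σ w = 1 := (Int.units_eq_one_or _).resolve_right hw
  have hne : ∀ {v}, σ v = 1 → v ≠ x := fun hv hvx => by simp [← hvx, hv] at hx
  have hflip := (reachWithin_refl (energy J h σ + 2 * J) σ).update_of_adj hL
    (hh.trans hhJ).le hx hxz hz (by linarith) (by simp; linarith)
  have hflip' := hflip.update_of_adj_adj (x := y) hL (hh.trans hhJ).le
    (by rw [Function.update_of_ne hxy.ne', hy]) (hne hw1).symm hxy.symm
    (Function.update_self _ _ _) hyw (by rw [Function.update_of_ne (hne hw1), hw1])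
    (by simp; linarith) (by simp; linarith)
  rw [add_assoc] at hflip'
  have := hσ.nonneg_of_reachWithin hflip'
  simp at this
  linarith

section IsTop

variable {a b : ZMod L} (hab : IsTop σ a b)
include hab

lemma inr_of_isTop : σ (.inr (a, b)) = -1 := by
  have : Fact (1 < L) := ⟨hL⟩
  exact (hσ.eq_of_adj_of_ne hL hh hhJ (adj_inl_below a b) (adj_inl_right a b) (by simp)
    (by simp [hab.1, hab.2])).trans hab.2

lemma inr_sub_one_of_isTop : σ (.inr (a - 1, b)) = -1 := by
  have : Fact (1 < L) := ⟨hL⟩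
  exact (hσ.eq_of_adj_of_ne hL hh hhJ (adj_inl_below a b) (adj_inl_left a b) (by simp)
    (by simp [hab.1, hab.2])).trans hab.2

lemma inl_add_one_of_isTop : σ (.inl (a + 1, b)) = -1 :=
  hσ.eq_neg_one_of_adj hL hh hhJ (adj_inl_right a b) hab.2 (hσ.inr_of_isTop hL hh hhJ hab)
    (adj_inl_below a b) hab.1 (adj_inr_right a b)

lemma inl_sub_one_of_isTop : σ (.inl (a - 1, b)) = -1 :=
  hσ.eq_neg_one_of_adj hL hh hhJ (adj_inl_left a b) hab.2
    (hσ.inr_sub_one_of_isTop hL hh hhJ hab) (adj_inl_below a b) hab.1 (adj_inr_left _ b)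

lemma inl_below_of_isTop : σ (.inl (a, b - 1)) = 1 := by
  have : Fact (1 < L) := ⟨hL⟩
  exact (hσ.eq_of_adj_of_ne hL hh hhJ (adj_inl_below a b).symm (adj_inr_left a (b - 1))
    (by simp [eq_sub_iff_add_eq]) (by simp [hab.1, hab.2])).trans hab.1

lemma inl_add_one_below_of_isTop : σ (.inl (a + 1, b - 1)) = 1 := by
  have : Fact (1 < L) := ⟨hL⟩
  exact (hσ.eq_of_adj_of_ne hL hh hhJ (adj_inl_below a b).symm (adj_inr_right a (b - 1))
    (by simp) (by simp [hab.1, hab.2])).trans hab.1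

end IsTop

lemma exists_not_isTop (b : ZMod L) : ∃ a, ¬IsTop σ a b := by
  by_contra! hrow
  obtain ⟨η, hη⟩ := reachWithin_fill_row hL hh hhJ
    (fun a => ⟨(hrow a).2, hσ.inr_of_isTop hL hh hhJ (hrow a)⟩) fun a => (hrow a).1
  have := hσ.nonneg_of_reachWithin (d := -(2 * L * h)) hη
  have : (2 : ℝ) ≤ L := by exact_mod_cast hL
  nlinarith

lemma exists_isSide (hone : IsTop σ (-1) 0) (hzero : ¬IsTop σ 0 0) : ∃ n, IsSide σ n := by
  classical
  have hlast : ¬IsTop σ (-(L - 1 + 1 : ℕ)) 0 := by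
    rwa [Nat.sub_add_cancel (NeZero.one_le), ZMod.natCast_self, neg_zero]
  have hex : ∃ n : ℕ, ¬IsTop σ (-(n + 1 : ℕ)) 0 := ⟨_, hlast⟩
  have hone_le : 1 ≤ Nat.find hex := by simpa using hone
  have hisTop : ∀ i : ℕ, 1 ≤ i → i ≤ Nat.find hex → IsTop σ (-i) 0 := by
    intro i hi hin
    have := Nat.find_min hex (m := i - 1) (by omega)
    rwa [not_not, Nat.sub_add_cancel hi] at this
  refine ⟨Nat.find hex, hone_le, ?_, hisTop, ?_, ?_⟩
  · exact (Nat.find_min' hex hlast).trans_lt (Nat.sub_lt (NeZero.pos L) one_pos)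
  · have hinl := hσ.inl_add_one_of_isTop hL hh hhJ hone
    rw [neg_add_cancel] at hinl
    by_contra h1
    exact hzero ⟨by simpa using (Int.units_eq_one_or _).resolve_right h1, hinl⟩
  · have hinl := hσ.inl_sub_one_of_isTop hL hh hhJ (hisTop _ hone_le le_rfl)
    by_contra h1
    refine Nat.find_spec hex ⟨by simpa using (Int.units_eq_one_or _).resolve_right h1, ?_⟩
    rwa [Nat.cast_succ, neg_add']

end IsTrap

end Traps

section Corner

variable {L : ℕ} {J h : ℝ} {σ : Config L} {n : ℕ}

lemma reflection_notMem_trapezoid_zero (hn : n < L) {x : Site L} {p q : ℕ}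
    (hx : x ∈ trapezoid 0 p q) : reflection x ∉ trapezoid 0 1 (n + 1) := by
  obtain ⟨i, -, rfl⟩ | ⟨i, -, rfl⟩ := hx
  · rintro (⟨j, -, hji⟩ | ⟨j, ⟨hj, hjn⟩, hji⟩)
    · simp at hji
    · obtain ⟨hj1, hi⟩ : -(j : ZMod L) = i - 1 ∧ 0 = -(i : ZMod L) := by simpa using hji
      exact natCast_zmod_ne (L := L) hj (by omega) (by grind)
  · rintro (⟨j, ⟨hj, hjn⟩, hji⟩ | ⟨j, -, hji⟩)
    · obtain ⟨hj0, hi⟩ : -(j : ZMod L) = i - 1 ∧ 0 = -(i : ZMod L) + 1 := by simpa using hji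
      exact natCast_zmod_ne (L := L) (i := 0) hj (by omega) (by grind)
    · simp at hji

lemma reflection_notMem_trapezoid_neg_one (hn : n < L) {x : Site L}
    (hx : x ∈ trapezoid (-1) 1 (n + 1)) {p q : ℕ} : reflection x ∉ trapezoid (-1) p q := by
  obtain ⟨i, ⟨hi, hin⟩, rfl⟩ | ⟨i, ⟨hi, hin⟩, rfl⟩ := hx
  · rintro (⟨j, -, hji⟩ | ⟨j, -, hji⟩)
    · simp at hji
    · obtain ⟨-, hi0⟩ : -(j : ZMod L) = i - 1 ∧ (i : ZMod L) = 0 := by simpa using hji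
      exact natCast_zmod_ne (L := L) (i := 0) hi (by omega) (by grind)
  · rintro (⟨j, -, hji⟩ | ⟨j, -, hji⟩)
    · obtain ⟨-, hi1⟩ : -(j : ZMod L) = i - 1 ∧ 1 = (i : ZMod L) := by simpa using hji
      exact natCast_zmod_ne (L := L) hi (by omega) (by simpa using hi1)
    · simp at hji

variable [NeZero L]

namespace IsTrap

variable (hσ : IsTrap J h σ) (hL : 2 ≤ L) (hh : 0 < h) (hhJ : h < J)
include hσ hL hh hhJ

section IsSide

variable (hn : IsSide σ n)
include hn

lemma eq_neg_one_of_isSide {x : Site L} (hx : x ∈ trapezoid 0 0 (n + 1)) : σ x = -1 := by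
  obtain ⟨i, ⟨-, hin⟩, rfl⟩ | ⟨i, ⟨hi, hin⟩, rfl⟩ := hx
  · obtain rfl | hi := i.eq_zero_or_pos
    · simpa using hσ.inl_add_one_of_isTop hL hh hhJ (hn.isTop 1 le_rfl hn.one_le)
    · exact (hn.isTop i hi (by omega)).2
  · exact hσ.inr_of_isTop hL hh hhJ (hn.isTop i hi (by omega))

lemma eq_one_of_isSide {x : Site L} (hx : x ∈ trapezoid (-1) 0 (n + 1)) : σ x = 1 := by
  obtain ⟨i, ⟨-, hin⟩, rfl⟩ | ⟨i, ⟨hi, hin⟩, rfl⟩ := hx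
  · obtain rfl | hi := i.eq_zero_or_pos
    · simpa using hσ.inl_add_one_below_of_isTop hL hh hhJ (hn.isTop 1 le_rfl hn.one_le)
    · simpa using hσ.inl_below_of_isTop hL hh hhJ (hn.isTop i hi (by omega))
  · simpa using (hn.isTop i hi (by omega)).1

lemma reachWithin_fill_side :
    ReachWithin J h (energy J h σ + 2 * J) (energy J h σ + (J - (2 * n - 1) * h)) σ
      (paint σ (trapezoid 0 1 (n + 1)) 1) := by
  have hfill := (reachWithin_refl (energy J h σ + 2 * J) σ).fill_trapezoid hL hh hhJ
    (b := 0) (p := 1) (q := n + 1) (by have := hn.one_le; omega) (by have := hn.lt_card; omega)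
    (fun x hx => hσ.eq_neg_one_of_isSide hL hh hhJ hn (trapezoid_mono zero_le_one le_rfl hx))
    (fun i hi hin => (hn.isTop i hi (by omega)).1) (by linarith)
  convert hfill using 1
  push_cast
  ring

lemma mul_lt_of_isSide : (2 * n - 1) * h < J := by
  have hfill := hσ.reachWithin_fill_side hL hh hhJ hn
  have := hσ.pos_of_reachWithin hfill (lt_paint_one
    (inl_mem_trapezoid le_rfl (by have := hn.one_le; omega)) (hn.isTop 1 le_rfl hn.one_le).2)
  linarith

lemma reachWithin_empty_side :
    ReachWithin J h (energy J h σ + 2 * J) (energy J h σ + (-J + (2 * n + 1) * h)) σ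
      (paint σ (trapezoid (-1) 0 (n + 1)) (-1)) := by
  have hlt := hσ.mul_lt_of_isSide hL hh hhJ hn
  have hempty := (reachWithin_refl (energy J h σ + 2 * J) σ).empty_trapezoid_of_left hL hh hhJ
    (b := -1) (p := 0) (q := n) n.zero_le (by have := hn.lt_card; omega)
    (fun x hx => hσ.eq_one_of_isSide hL hh hhJ hn hx) (by simpa using hn.right) hn.left
    (fun i hi hin => by simpa using (hn.isTop i hi hin).2) (by push_cast; linarith)
  convert hempty using 1
  push_cast
  ring

lemma le_mul_of_isSide : J ≤ (2 * n + 1) * h := by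
  have := hσ.nonneg_of_reachWithin (hσ.reachWithin_empty_side hL hh hhJ hn)
  linarith

end IsSide

lemma isSide_unique {τ : Config L} (hτ : IsTrap J h τ) {m : ℕ} (hn : IsSide σ n)
    (hm : IsSide τ m) : m = n := by
  have hle : ∀ {k l : ℕ}, (2 * k - 1) * h < J → J ≤ (2 * l + 1) * h → k ≤ l := by
    intro k l hk hl
    have : (2 * k - 1 : ℝ) < 2 * l + 1 := lt_of_mul_lt_mul_right (hk.trans_le hl) hh.le
    have : (k : ℝ) < l + 1 := by linarith
    exact Nat.lt_succ_iff.1 (by exact_mod_cast this)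
  exact (hle (hτ.mul_lt_of_isSide hL hh hhJ hm) (hσ.le_mul_of_isSide hL hh hhJ hn)).antisymm
    (hle (hσ.mul_lt_of_isSide hL hh hhJ hn) (hτ.le_mul_of_isSide hL hh hhJ hm))

lemma lt_of_isSide_reflection (hn : IsSide σ n) (hn' : IsSide (σ ∘ reflection) n) :
    2 * n * h < J := by
  by_contra! hJn
  have hσ' := hσ.comp reflection
  set η := paint σ (trapezoid 0 1 (n + 1)) 1
  have hηminus : ∀ x ∈ trapezoid 0 0 (n + 1), (η ∘ reflection) x = -1 := fun x hx =>
    (paint_of_notMem (reflection_notMem_trapezoid_zero hn.lt_card hx)).trans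
      (hσ'.eq_neg_one_of_isSide hL hh hhJ hn' hx)
  have hbelow : ∀ i : ℕ, i ≤ n → (η ∘ reflection) (.inr (-i, 0 - 1)) = 1 := by
    intro i hin
    obtain rfl | hi := i.eq_zero_or_pos
    · have hmem : .inl (-(1 : ℕ), 0) ∈ trapezoid (L := L) 0 1 (n + 1) :=
        inl_mem_trapezoid le_rfl (Nat.lt_succ_of_le hn.one_le)
      exact paint_of_mem (by simpa using hmem)
    · exact paint_of_eq (hn'.isTop i hi hin).1
  have hfilled := ((hσ.reachWithin_fill_side hL hh hhJ hn).comp reflection).fill_trapezoid hL hh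
    hhJ (b := 0) (p := 0) (q := n + 1) n.succ_pos (by have := hn.lt_card; omega)
    hηminus (fun i _ hin => hbelow i (by omega)) (by linarith)
  have hmem : .inl (-(0 : ℕ), 0) ∈ trapezoid (L := L) 0 0 (n + 1) :=
    inl_mem_trapezoid le_rfl n.succ_pos
  have hlt' : σ ∘ reflection < paint (η ∘ reflection) (trapezoid 0 0 (n + 1)) 1 :=
    (show σ ∘ reflection ≤ η ∘ reflection from fun x => le_paint_one _).trans_lt
      (lt_paint_one hmem (hηminus _ hmem))
  rw [← energy_comp J h σ reflection, add_assoc] at hfilled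
  have hpos := hσ'.pos_of_reachWithin hfilled hlt'
  push_cast at hpos
  linarith

lemma le_of_isSide_reflection (hn : IsSide σ n) (hn' : IsSide (σ ∘ reflection) n) :
    J ≤ 2 * n * h := by
  by_contra! hJn
  have hσ' := hσ.comp reflection
  have hright : paint σ (trapezoid (-1) 0 (n + 1)) (-1) (reflection (.inr (-(1 : ℕ), -1))) = -1 :=
    paint_of_mem (by simpa using inl_mem_trapezoid (L := L) (b := -1) le_rfl n.succ_pos)
  have hemptied := ((hσ.reachWithin_empty_side hL hh hhJ hn).comp
    reflection).empty_trapezoid_of_left hL hh hhJ (b := -1) (p := 1) (q := n) hn.one_le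
    (by have := hn.lt_card; omega)
    (fun x hx => (paint_of_notMem (reflection_notMem_trapezoid_neg_one hn.lt_card hx)).trans
      (hσ'.eq_one_of_isSide hL hh hhJ hn' (trapezoid_mono zero_le_one le_rfl hx)))
    hright (paint_of_eq hn'.left)
    (fun i hi hin => paint_of_eq (by simpa using (hn'.isTop i hi.le hin).2))
    (by push_cast; linarith)
  rw [← energy_comp J h σ reflection] at hemptied
  have := hσ'.nonneg_of_reachWithin (d := -(2 * J) + 4 * n * h)
    (by convert hemptied using 1; push_cast; ring)
  linarith

lemma isTop_zero (hone : IsTop σ (-1) 0) : IsTop σ 0 0 := by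
  by_contra hzero
  obtain ⟨n, hn⟩ := hσ.exists_isSide hL hh hhJ hone hzero
  have hσ' := hσ.comp reflection
  have hone' : IsTop (σ ∘ reflection) (-1) 0 :=
    ⟨by simpa using hσ.inl_add_one_below_of_isTop hL hh hhJ hone, by simpa using hn.right⟩
  have hzero' : ¬IsTop (σ ∘ reflection) 0 0 := fun hzero' => by
    simpa [hone.2] using hzero'.1
  obtain ⟨m, hm⟩ := hσ'.exists_isSide hL hh hhJ hone' hzero'
  obtain rfl := hσ.isSide_unique hL hh hhJ hσ' hn hm
  exact (hσ.lt_of_isSide_reflection hL hh hhJ hn hm).not_ge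
    (hσ.le_of_isSide_reflection hL hh hhJ hn hm)

lemma isTop_add_one {a b : ZMod L} (hab : IsTop σ a b) : IsTop σ (a + 1) b := by
  have hzero := (hσ.comp (translation (a + 1, b))).isTop_zero hL hh hhJ
  simp only [IsTop, Function.comp_apply, translation_inl, translation_inr, Prod.mk_add_mk,
    zero_sub, zero_add, neg_add_eq_sub, add_sub_cancel_right] at hzero
  exact hzero hab

lemma not_isTop (a b : ZMod L) : ¬IsTop σ a b := by
  intro hab
  have hrow : ∀ i : ℕ, IsTop σ (a + i) b := by
    intro i
    induction i with
    | zero => simpa using hab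
    | succ i ih => simpa [add_assoc] using hσ.isTop_add_one hL hh hhJ ih
  obtain ⟨c, hc⟩ := hσ.exists_not_isTop hL hh hhJ b
  exact hc (by simpa using hrow (c - a).val)

lemma eq_one_of_adj {x y : Site L} (hxy : (hexTorus L).Adj x y) (hx : σ x = 1) : σ y = 1 := by
  obtain ⟨φ, rfl, rfl⟩ := exists_iso_arc hxy
  by_contra hy
  exact (hσ.comp φ).not_isTop hL hh hhJ 0 0
    ⟨by simpa using hx, (Int.units_eq_one_or _).resolve_left hy⟩

lemma eq_allMinus_or_eq_allPlus : σ = allMinus L ∨ σ = allPlus L := by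
  by_contra! hne
  obtain ⟨x, hx⟩ := Function.ne_iff.1 hne.1
  refine hne.2 (funext fun y => ?_)
  obtain ⟨w⟩ := hexTorus_preconnected L x y
  induction w with
  | nil => exact (Int.units_eq_one_or _).resolve_right hx
  | cons hadj _ ih =>
    refine ih fun hminus => ?_
    rw [hσ.eq_one_of_adj hL hh hhJ hadj ((Int.units_eq_one_or _).resolve_right hx)] at hminus
    exact absurd hminus (by simp [allMinus])

end IsTrap
end Corner

/-! ### Survival probabilities of finite Markov chains -/

section Survival

open Matrix

variable {X : Type*} [Fintype X] {P : Matrix X X ℝ} {B : Set X}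

/-- The probability that the Markov chain with transition matrix `P` started from `x` avoids `B` at
the times `0, …, n`, as a function of `n` and `x`. -/
noncomputable def survival (P : Matrix X X ℝ) (B : Set X) : ℕ → X → ℝ
  | 0 => Bᶜ.indicator 1
  | n + 1 => Bᶜ.indicator (P *ᵥ survival P B n)

lemma survival_of_mem (n : ℕ) {x : X} (hx : x ∈ B) : survival P B n x = 0 := by
  cases n <;> simp [survival, hx]

lemma survival_zero {x : X} (hx : x ∉ B) : survival P B 0 x = 1 := by simp [survival, hx]

lemma survival_succ (n : ℕ) {x : X} (hx : x ∉ B) :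
    survival P B (n + 1) x = ∑ y, P x y * survival P B n y := by
  simp [survival, hx, mulVec, dotProduct]

lemma survival_pair_le_mul {m s : X} {R : ℕ} {ε : ℝ} (hε : ∀ x, survival P {m, s} R x ≤ ε)
    (x : X) : survival P {m, s} R x ≤ ε * survival P {s} 0 x := by
  by_cases hs : x ∈ ({s} : Set X)
  · rw [survival_of_mem _ (Set.mem_insert_of_mem m hs), survival_of_mem _ hs, mul_zero]
  · rw [survival_zero hs, mul_one]
    exact hε x

section Nonneg

variable (hP : ∀ x y, 0 ≤ P x y)
include hP

lemma survival_nonneg (n : ℕ) (x : X) : 0 ≤ survival P B n x := by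
  induction n generalizing x with
  | zero => exact Set.indicator_nonneg (fun _ _ => zero_le_one) x
  | succ n ih =>
    exact Set.indicator_nonneg
      (fun x _ => Finset.sum_nonneg fun y _ => mul_nonneg (hP x y) (ih y)) x

lemma survival_le_survival_of_subset {C : Set X} (hBC : B ⊆ C) (n : ℕ) (x : X) :
    survival P C n x ≤ survival P B n x := by
  induction n generalizing x with
  | zero =>
    exact Set.indicator_le_indicator_of_subset (Set.compl_subset_compl.2 hBC)
      (fun _ => zero_le_one) x
  | succ n ih =>
    by_cases hx : x ∈ C
    · rw [survival_of_mem _ hx]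
      exact survival_nonneg hP _ x
    · rw [survival_succ _ hx, survival_succ _ fun h => hx (hBC h)]
      exact Finset.sum_le_sum fun y _ => mul_le_mul_of_nonneg_left (ih y) (hP x y)

lemma mul_survival_add_le {a b c : ℝ} {i j k : ℕ}
    (H : ∀ x, a * survival P B i x ≤ b * survival P B j x + c * survival P B k x) (n : ℕ) (x : X) :
    a * survival P B (n + i) x ≤ b * survival P B (n + j) x + c * survival P B (n + k) x := by
  induction n generalizing x with
  | zero => simpa only [zero_add] using H x
  | succ n ih =>
    by_cases hx : x ∈ B
    · simp only [survival_of_mem _ hx, mul_zero, add_zero, le_refl]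
    · simp only [Nat.add_right_comm n 1, survival_succ _ hx, Finset.mul_sum]
      rw [← Finset.sum_add_distrib]
      refine Finset.sum_le_sum fun y _ => ?_
      linarith [mul_le_mul_of_nonneg_left (ih y) (hP x y)]

end Nonneg

section Stochastic

variable [DecidableEq X] (hP : P ∈ rowStochastic ℝ X)
include hP

lemma survival_le_one (n : ℕ) (x : X) : survival P B n x ≤ 1 := by
  induction n generalizing x with
  | zero => exact Set.indicator_apply_le' (fun _ => le_rfl) fun _ => zero_le_one
  | succ n ih =>
    refine Set.indicator_apply_le' (fun _ => ?_) fun _ => zero_le_one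
    calc ∑ y, P x y * survival P B n y
        ≤ ∑ y, P x y := Finset.sum_le_sum fun y _ => mul_le_of_le_one_right (hP.1 x y) (ih y)
      _ = 1 := sum_row_of_mem_rowStochastic hP x

lemma survival_succ_le (n : ℕ) (x : X) : survival P B (n + 1) x ≤ survival P B n x := by
  induction n generalizing x with
  | zero =>
    by_cases hx : x ∈ B
    · rw [survival_of_mem _ hx, survival_of_mem _ hx]
    · rw [survival_zero hx]
      exact survival_le_one hP _ x
  | succ n ih =>
    by_cases hx : x ∈ B
    · rw [survival_of_mem _ hx, survival_of_mem _ hx]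
    · rw [survival_succ _ hx, survival_succ _ hx]
      exact Finset.sum_le_sum fun y _ => mul_le_mul_of_nonneg_left (ih y) (hP.1 x y)

lemma survival_antitone (x : X) : Antitone fun n => survival P B n x :=
  antitone_nat_of_succ_le fun n => survival_succ_le hP n x

lemma one_sub_survival_le {x : X} (hx : x ∉ B) (n : ℕ) :
    1 - survival P B n x ≤ n * (1 - P x x) := by
  induction n with
  | zero => simp [survival_zero hx]
  | succ n ih =>
    have hstay : P x x * survival P B n x ≤ survival P B (n + 1) x := by
      rw [survival_succ n hx]
      exact Finset.single_le_sum (f := fun y => P x y * survival P B n y)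
        (fun y _ => mul_nonneg (hP.1 x y) (survival_nonneg hP.1 n y)) (Finset.mem_univ x)
    have hPx : 0 ≤ 1 - P x x := sub_nonneg.2 (le_one_of_mem_rowStochastic hP)
    have hle : 0 ≤ 1 - survival P B n x := sub_nonneg.2 (survival_le_one hP n x)
    push_cast
    linarith [mul_nonneg hPx hle]

end Stochastic

end Survival

section Reversible

open Matrix

variable {X : Type*} [Fintype X] {P : Matrix X X ℝ} {B : Set X} {μ : X → ℝ}

/-- The Dirichlet form of the Markov chain with transition matrix `P` and reversible weight `μ`. -/
noncomputable def dirichletForm (μ : X → ℝ) (P : Matrix X X ℝ) (f : X → ℝ) : ℝ :=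
  (∑ x, ∑ y, μ x * P x y * (f x - f y) ^ 2) / 2

section Symmetric

variable (hrev : ∀ x y, μ x * P x y = μ y * P y x)
include hrev

lemma sum_mul_survival_succ_mul_survival (n k : ℕ) :
    ∑ x, μ x * (survival P B (n + 1) x * survival P B k x)
      = ∑ x, μ x * (survival P B n x * survival P B (k + 1) x) := by
  have expand (i j : ℕ) (x : X) : μ x * (survival P B (i + 1) x * survival P B j x)
      = ∑ y, μ x * P x y * (survival P B i y * survival P B j x) := by
    by_cases hx : x ∈ B
    · simp [survival_of_mem _ hx]
    · rw [survival_succ _ hx, Finset.sum_mul, Finset.mul_sum]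
      exact Finset.sum_congr rfl fun y _ => by ring
  calc ∑ x, μ x * (survival P B (n + 1) x * survival P B k x)
      = ∑ x, ∑ y, μ x * P x y * (survival P B n y * survival P B k x) := by simp only [expand]
    _ = ∑ y, ∑ x, μ y * P y x * (survival P B k x * survival P B n y) := by
        rw [Finset.sum_comm]
        refine Finset.sum_congr rfl fun y _ => Finset.sum_congr rfl fun x _ => ?_
        rw [hrev x y, mul_comm (survival P B n y)]
    _ = ∑ x, μ x * (survival P B n x * survival P B (k + 1) x) := by
        refine Finset.sum_congr rfl fun x _ => ?_
        rw [← expand, mul_comm (survival P B n x)]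

lemma sum_mul_survival_mul_survival (n k : ℕ) :
    ∑ x, μ x * (survival P B n x * survival P B k x) = ∑ x, μ x * survival P B (n + k) x := by
  induction n generalizing k with
  | zero =>
    refine Finset.sum_congr rfl fun x _ => ?_
    by_cases hx : x ∈ B
    · simp [survival_of_mem _ hx]
    · simp [survival_zero hx]
  | succ n ih =>
    rw [sum_mul_survival_succ_mul_survival hrev, ih, Nat.add_right_comm, add_assoc]

end Symmetric

variable [DecidableEq X] (hP : P ∈ rowStochastic ℝ X) (hrev : ∀ x y, μ x * P x y = μ y * P y x)
include hP hrev

lemma dirichletForm_eq (f : X → ℝ) :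
    dirichletForm μ P f = ∑ x, μ x * (f x * f x) - ∑ x, μ x * (f x * (P *ᵥ f) x) := by
  have hdiag : ∑ x, ∑ y, μ x * P x y * f x ^ 2 = ∑ x, μ x * (f x * f x) := by
    refine Finset.sum_congr rfl fun x _ => ?_
    rw [← Finset.sum_mul, ← Finset.mul_sum, sum_row_of_mem_rowStochastic hP]
    ring
  have hdiag' : ∑ x, ∑ y, μ x * P x y * f y ^ 2 = ∑ x, μ x * (f x * f x) := by
    rw [← hdiag, Finset.sum_comm]
    simp only [hrev]
  have hcross : ∑ x, ∑ y, μ x * P x y * (f x * f y) = ∑ x, μ x * (f x * (P *ᵥ f) x) := by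
    simp only [mulVec, dotProduct, Finset.mul_sum]
    exact Finset.sum_congr rfl fun x _ => Finset.sum_congr rfl fun y _ => by ring
  have hexpand : ∑ x, ∑ y, μ x * P x y * (f x - f y) ^ 2
      = ∑ x, ∑ y, (μ x * P x y * f x ^ 2 + μ x * P x y * f y ^ 2
        - 2 * (μ x * P x y * (f x * f y))) :=
    Finset.sum_congr rfl fun x _ => Finset.sum_congr rfl fun y _ => by ring
  rw [dirichletForm, hexpand]
  simp only [Finset.sum_sub_distrib, Finset.sum_add_distrib, ← Finset.mul_sum]
  rw [hdiag, hdiag', hcross]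
  ring

lemma dirichletForm_survival (n : ℕ) :
    dirichletForm μ P (survival P B n)
      = ∑ x, μ x * survival P B (n + n) x - ∑ x, μ x * survival P B (n + (n + 1)) x := by
  rw [dirichletForm_eq hP hrev, sum_mul_survival_mul_survival hrev,
    ← sum_mul_survival_mul_survival hrev n (n + 1)]
  congr 1
  refine Finset.sum_congr rfl fun x _ => ?_
  by_cases hx : x ∈ B
  · simp only [survival_of_mem _ hx, zero_mul]
  · rw [survival_succ n hx]
    rfl

variable (hμ : ∀ x, 0 < μ x) {C : ℝ} (hC : 0 < C)
  (hpoincare : ∀ f : X → ℝ, (∀ x ∈ B, f x = 0) → ∑ x, μ x * f x ^ 2 ≤ C * dirichletForm μ P f)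
include hμ hC hpoincare

lemma sum_mul_survival_two_mul_succ_le (n : ℕ) :
    ∑ x, μ x * survival P B (2 * (n + 1)) x
      ≤ Real.exp (-(1 / C)) * ∑ x, μ x * survival P B (2 * n) x := by
  have hsq : ∑ x, μ x * survival P B n x ^ 2 = ∑ x, μ x * survival P B (2 * n) x := by
    simp only [sq, two_mul, sum_mul_survival_mul_survival hrev]
  have hgap : (∑ x, μ x * survival P B (2 * n) x) / C
      ≤ ∑ x, μ x * survival P B (2 * n) x - ∑ x, μ x * survival P B (n + (n + 1)) x := by
    rw [div_le_iff₀' hC, ← hsq]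
    refine (hpoincare _ fun x => survival_of_mem n).trans_eq ?_
    rw [dirichletForm_survival hP hrev, hsq, two_mul]
  have hnonneg : 0 ≤ ∑ x, μ x * survival P B (2 * n) x :=
    Finset.sum_nonneg fun x _ => mul_nonneg (hμ x).le (survival_nonneg hP.1 _ x)
  calc ∑ x, μ x * survival P B (2 * (n + 1)) x
      ≤ ∑ x, μ x * survival P B (n + (n + 1)) x :=
        Finset.sum_le_sum fun x _ =>
          mul_le_mul_of_nonneg_left (survival_antitone hP x (by lia)) (hμ x).le
    _ ≤ (-(1 / C) + 1) * ∑ x, μ x * survival P B (2 * n) x := by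
        rw [add_mul, neg_mul, one_mul, one_div_mul_eq_div]
        linarith
    _ ≤ Real.exp (-(1 / C)) * ∑ x, μ x * survival P B (2 * n) x :=
        mul_le_mul_of_nonneg_right (Real.add_one_le_exp _) hnonneg

lemma sum_mul_survival_two_mul_le (n : ℕ) :
    ∑ x, μ x * survival P B (2 * n) x ≤ Real.exp (-(n / C)) * ∑ x, μ x := by
  induction n with
  | zero =>
    simpa using Finset.sum_le_sum fun x _ =>
      mul_le_of_le_one_right (hμ x).le (survival_le_one (B := B) hP 0 x)
  | succ n ih =>
    have hexp : Real.exp (-(((n + 1 : ℕ) : ℝ) / C))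
        = Real.exp (-(1 / C)) * Real.exp (-(n / C)) := by
      rw [← Real.exp_add]
      push_cast
      ring_nf
    rw [hexp, mul_assoc]
    exact (sum_mul_survival_two_mul_succ_le hP hrev hμ hC hpoincare n).trans
      (mul_le_mul_of_nonneg_left ih (Real.exp_pos _).le)

lemma survival_two_mul_le (n : ℕ) (x : X) :
    survival P B (2 * n) x ≤ (∑ y, μ y) / μ x * Real.exp (-(n / C)) := by
  rw [div_mul_eq_mul_div, le_div_iff₀' (hμ x), mul_comm (∑ y, μ y)]
  exact (Finset.single_le_sum (f := fun x => μ x * survival P B (2 * n) x)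
    (fun y _ => mul_nonneg (hμ y).le (survival_nonneg hP.1 _ y)) (Finset.mem_univ x)).trans
    (sum_mul_survival_two_mul_le hP hrev hμ hC hpoincare n)

end Reversible

section Factorization

open Matrix

variable {X : Type*} [Fintype X] [DecidableEq X] {P : Matrix X X ℝ} (hP : P ∈ rowStochastic ℝ X)
  {m s : X}
include hP

lemma survival_add_le (r k : ℕ) (x : X) :
    survival P {s} (r + k) x ≤ survival P {m, s} r x + survival P {s} k m := by
  induction r generalizing x with
  | zero =>
    rcases eq_or_ne x m with rfl | hm
    · rw [zero_add]
      exact le_add_of_nonneg_left (survival_nonneg hP.1 _ _)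
    by_cases hs : x ∈ ({s} : Set X)
    · rw [survival_of_mem _ hs]
      exact add_nonneg (survival_nonneg hP.1 _ _) (survival_nonneg hP.1 _ _)
    · rw [survival_zero (B := {m, s}) (by simp_all)]
      exact le_add_of_le_of_nonneg (survival_le_one hP _ x) (survival_nonneg hP.1 _ _)
  | succ r ih =>
    rcases eq_or_ne x m with rfl | hm
    · exact le_add_of_nonneg_of_le (survival_nonneg hP.1 _ _) (survival_antitone hP x (by lia))
    by_cases hs : x ∈ ({s} : Set X)
    · rw [survival_of_mem _ hs]
      exact add_nonneg (survival_nonneg hP.1 _ _) (survival_nonneg hP.1 _ _)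
    · rw [Nat.add_right_comm, survival_succ _ hs, survival_succ (B := {m, s}) _ (by simp_all)]
      calc ∑ y, P x y * survival P {s} (r + k) y
          ≤ ∑ y, P x y * (survival P {m, s} r y + survival P {s} k m) :=
            Finset.sum_le_sum fun y _ => mul_le_mul_of_nonneg_left (ih y) (hP.1 x y)
        _ = ∑ y, P x y * survival P {m, s} r y + survival P {s} k m := by
            simp only [mul_add, Finset.sum_add_distrib]
            rw [← Finset.sum_mul, sum_row_of_mem_rowStochastic hP, one_mul]

lemma survival_sub_mul_survival_le (r k : ℕ) (x : X) :
    (survival P {s} r x - survival P {m, s} r x) * survival P {s} k m ≤ survival P {s} k x := by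
  have hsub (r : ℕ) (x : X) : 0 ≤ survival P {s} r x - survival P {m, s} r x :=
    sub_nonneg.2 (survival_le_survival_of_subset hP.1 (by simp) r x)
  have hsub_le_one (r : ℕ) (x : X) : survival P {s} r x - survival P {m, s} r x ≤ 1 := by
    linarith [survival_le_one hP (B := {s}) r x, survival_nonneg hP.1 (B := {m, s}) r x]
  induction r generalizing x k with
  | zero =>
    rcases eq_or_ne x m with rfl | hm
    · exact mul_le_of_le_one_left (survival_nonneg hP.1 _ _) (hsub_le_one 0 x)
    · rw [show survival P {s} 0 x = survival P {m, s} 0 x by simp [survival, Set.indicator, hm],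
        sub_self, zero_mul]
      exact survival_nonneg hP.1 _ _
  | succ r ih =>
    rcases eq_or_ne x m with rfl | hm
    · exact mul_le_of_le_one_left (survival_nonneg hP.1 _ _) (hsub_le_one _ x)
    by_cases hs : x ∈ ({s} : Set X)
    · simp [survival_of_mem (B := {m, s}) _ (Set.mem_insert_of_mem m hs), survival_of_mem _ hs]
    rcases k with _ | k
    · rw [survival_zero hs]
      exact mul_le_one₀ (hsub_le_one _ x) (survival_nonneg hP.1 _ _) (survival_le_one hP _ _)
    calc (survival P {s} (r + 1) x - survival P {m, s} (r + 1) x) * survival P {s} (k + 1) m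
        ≤ (survival P {s} (r + 1) x - survival P {m, s} (r + 1) x) * survival P {s} k m :=
          mul_le_mul_of_nonneg_left (survival_succ_le hP k m) (hsub _ x)
      _ = ∑ y, P x y * ((survival P {s} r y - survival P {m, s} r y) * survival P {s} k m) := by
          rw [survival_succ _ hs, survival_succ (B := {m, s}) _ (by simp_all),
            ← Finset.sum_sub_distrib, Finset.sum_mul]
          exact Finset.sum_congr rfl fun y _ => by ring
      _ ≤ ∑ y, P x y * survival P {s} k y :=
          Finset.sum_le_sum fun y _ => mul_le_mul_of_nonneg_left (ih k y) (hP.1 x y)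
      _ = survival P {s} (k + 1) x := (survival_succ k hs).symm

section Recurrent

variable {R : ℕ} {ε : ℝ} (hε : ∀ x, survival P {m, s} R x ≤ ε)
include hε

lemma survival_add_le_mul (n k : ℕ) :
    survival P {s} (n + (R + k)) m ≤ survival P {s} n m * (survival P {s} k m + ε) := by
  have hbase (x : X) : 1 * survival P {s} (R + k) x
      ≤ survival P {s} k m * survival P {s} 0 x + ε * survival P {s} 0 x := by
    by_cases hs : x ∈ ({s} : Set X)
    · simp [survival_of_mem _ hs]
    · have hpair := survival_pair_le_mul hε x
      rw [survival_zero hs] at hpair ⊢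
      linarith [survival_add_le hP (m := m) (s := s) R k x]
  have hshift := mul_survival_add_le hP.1 hbase n m
  rw [add_zero, one_mul] at hshift
  linarith

lemma survival_mul_sub_le (n k : ℕ) :
    survival P {s} k m * (survival P {s} (n + R) m - ε * survival P {s} n m)
      ≤ survival P {s} (n + k) m := by
  have hbase (x : X) : survival P {s} k m * survival P {s} R x
      ≤ 1 * survival P {s} k x + survival P {s} k m * ε * survival P {s} 0 x := by
    have hpair := mul_le_mul_of_nonneg_left (survival_pair_le_mul hε x)
      (survival_nonneg hP.1 (B := {s}) k m)
    linarith [survival_sub_mul_survival_le hP (m := m) (s := s) R k x]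
  have hshift := mul_survival_add_le hP.1 hbase n m
  rw [add_zero] at hshift
  linarith

/-- The chain cannot be killed at a sizeable rate in a window of length `R`: at the start of the
preceding window it would be killed or return to `m`, from where it survives `2 R` steps. -/
lemma survival_sub_survival_add_le (n : ℕ) :
    survival P {s} n m - survival P {s} (n + R) m ≤ ε + (1 - survival P {s} (R + R) m) := by
  have hε0 : 0 ≤ ε := (survival_nonneg hP.1 R m).trans (hε m)
  have hle (n : ℕ) : survival P {s} n m ≤ 1 := survival_le_one hP n m
  rcases lt_or_ge n R with hn | hn
  · have hanti : survival P {s} (R + R) m ≤ survival P {s} (n + R) m :=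
      survival_antitone hP m (by lia)
    linarith [hle n]
  obtain ⟨n, rfl⟩ := Nat.exists_eq_add_of_le' hn
  have hbase (x : X) : 1 * survival P {s} R x ≤ 1 * survival P {s} (R + R) x
      + (ε + (1 - survival P {s} (R + R) m)) * survival P {s} 0 x := by
    have hpair := survival_pair_le_mul hε x
    have hsub := survival_sub_mul_survival_le hP (m := m) (s := s) R (R + R) x
    have hexit : (survival P {s} R x - survival P {m, s} R x) * (1 - survival P {s} (R + R) m)
        ≤ survival P {s} 0 x * (1 - survival P {s} (R + R) m) := by
      refine mul_le_mul_of_nonneg_right ?_ (sub_nonneg.2 (hle _))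
      linarith [survival_nonneg hP.1 (B := {m, s}) R x,
        survival_antitone hP (B := {s}) x (Nat.zero_le R)]
    linarith
  have hshift := mul_survival_add_le hP.1 hbase n m
  have hmul := mul_le_of_le_one_right (add_nonneg hε0 (sub_nonneg.2 (hle (R + R)))) (hle (n + 0))
  rw [add_assoc n R R]
  linarith

end Recurrent

end Factorization

/-! ### Almost memoryless laws -/

/-- The tail `n ↦ ℙ(τ > n)` of a law on the positive integers which is memoryless up to `δ` and
gives mass at most `δ` to `1`. -/
structure AlmostMemoryless (δ : ℝ) (s : ℕ → ℝ) : Prop where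
  zero : s 0 = 1
  antitone : Antitone s
  nonneg (n : ℕ) : 0 ≤ s n
  abs_add_sub_mul_le (n k : ℕ) : |s (n + k) - s n * s k| ≤ δ
  one_sub_one_le : 1 - s 1 ≤ δ

lemma tendsto_of_antitone_of_forall_rat {ι : Type*} {l : Filter ι} {F : ι → ℝ → ℝ} {g : ℝ → ℝ}
    {t : ℝ} {U : Set ℝ} (hF : ∀ i, Antitone (F i)) (hg : ContinuousAt g t) (hU : U ∈ 𝓝 t)
    (hlim : ∀ r : ℚ, (r : ℝ) ∈ U → Tendsto (fun i => F i r) l (𝓝 (g r))) :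
    Tendsto (fun i => F i t) l (𝓝 (g t)) := by
  refine tendsto_order.2 ⟨fun a ha => ?_, fun a ha => ?_⟩
  · obtain ⟨u, v, ⟨hu, hv⟩, huv⟩ := mem_nhds_iff_exists_Ioo_subset.1
      (inter_mem hU (hg.eventually (lt_mem_nhds ha)))
    obtain ⟨r, htr, hrv⟩ := exists_rat_btwn hv
    obtain ⟨hrU, har⟩ := huv ⟨hu.trans htr, hrv⟩
    filter_upwards [(hlim r hrU).eventually (lt_mem_nhds har)] with i hi
    exact hi.trans_le (hF i htr.le)
  · obtain ⟨u, v, ⟨hu, hv⟩, huv⟩ := mem_nhds_iff_exists_Ioo_subset.1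
      (inter_mem hU (hg.eventually (gt_mem_nhds ha)))
    obtain ⟨r, hur, hrt⟩ := exists_rat_btwn hu
    obtain ⟨hrU, har⟩ := huv ⟨hur, hrt.trans hv⟩
    filter_upwards [(hlim r hrU).eventually (gt_mem_nhds har)] with i hi
    exact (hF i hrt.le).trans_lt hi

namespace AlmostMemoryless

section Sequence

variable {δ : ℝ} {s : ℕ → ℝ} (hs : AlmostMemoryless δ s)
include hs

lemma le_one (n : ℕ) : s n ≤ 1 := hs.zero ▸ hs.antitone n.zero_le

lemma sub_succ_le (n : ℕ) : s n - s (n + 1) ≤ 2 * δ := by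
  have hmul := (abs_le.1 (hs.abs_add_sub_mul_le n 1)).1
  have hone : s n * (1 - s 1) ≤ 1 - s 1 :=
    mul_le_of_le_one_left (sub_nonneg.2 (hs.le_one 1)) (hs.le_one n)
  linarith [hs.one_sub_one_le]

lemma abs_floor_add_sub_mul_le (T : ℕ) {t r : ℝ} (ht : 0 ≤ t) (hr : 0 ≤ r) :
    |s ⌊(t + r) * T⌋₊ - s ⌊t * T⌋₊ * s ⌊r * T⌋₊| ≤ 3 * δ := by
  have hmul := abs_le.1 (hs.abs_add_sub_mul_le ⌊t * T⌋₊ ⌊r * T⌋₊)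
  have hle : ⌊t * T⌋₊ + ⌊r * T⌋₊ ≤ ⌊(t + r) * T⌋₊ := by
    refine Nat.le_floor ?_
    push_cast
    linarith [Nat.floor_le (by positivity : 0 ≤ t * T), Nat.floor_le (by positivity : 0 ≤ r * T)]
  have hlt : ⌊(t + r) * T⌋₊ ≤ ⌊t * T⌋₊ + ⌊r * T⌋₊ + 1 := by
    refine Nat.lt_succ_iff.1 ((Nat.floor_lt (by positivity)).2 ?_)
    push_cast
    linarith [Nat.lt_floor_add_one (t * T), Nat.lt_floor_add_one (r * T)]
  have hjump := hs.sub_succ_le (⌊t * T⌋₊ + ⌊r * T⌋₊)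
  exact abs_le.2 ⟨by linarith [hs.antitone hlt], by linarith [hs.antitone hle]⟩

end Sequence

section Limit

variable {ι : Type*} {l : Filter ι} {s : ι → ℕ → ℝ} {T : ι → ℕ} {δ : ι → ℝ}
  (hs : ∀ i, AlmostMemoryless (δ i) (s i)) (hδ : Tendsto δ l (𝓝 0))
include hs hδ

lemma tendsto_floor_add_sub_mul {t r : ℝ} (ht : 0 ≤ t) (hr : 0 ≤ r) :
    Tendsto (fun i => s i ⌊(t + r) * T i⌋₊ - s i ⌊t * T i⌋₊ * s i ⌊r * T i⌋₊) l (𝓝 0) :=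
  squeeze_zero_norm (fun i => (hs i).abs_floor_add_sub_mul_le (T i) ht hr)
    (by simpa using hδ.const_mul 3)

lemma tendsto_floor_natCast_mul_sub_pow {t : ℝ} (ht : 0 ≤ t) (k : ℕ) :
    Tendsto (fun i => s i ⌊(k * t) * T i⌋₊ - s i ⌊t * T i⌋₊ ^ k) l (𝓝 0) := by
  induction k with
  | zero => simp [(hs _).zero, tendsto_const_nhds]
  | succ k ih =>
    have hbdd : IsBoundedUnder (· ≤ ·) l (norm ∘ fun i => s i ⌊t * T i⌋₊) :=
      isBoundedUnder_of ⟨1, fun i => by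
        simpa [abs_of_nonneg ((hs i).nonneg _)] using (hs i).le_one _⟩
    have hstep := (tendsto_floor_add_sub_mul hs hδ (T := T) (by positivity : 0 ≤ k * t) ht).add
      (ih.zero_mul_isBoundedUnder_le hbdd)
    rw [add_zero] at hstep
    refine hstep.congr fun i => ?_
    rw [pow_succ, Nat.cast_succ, add_one_mul (k : ℝ) t]
    ring

variable (hT : Tendsto (fun i => s i (T i)) l (𝓝 (Real.exp (-1))))
include hT

lemma tendsto_floor_inv_mul {q : ℕ} (hq : q ≠ 0) :
    Tendsto (fun i => s i ⌊(q : ℝ)⁻¹ * T i⌋₊) l (𝓝 (Real.exp (-(q : ℝ)⁻¹))) := by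
  have hpow : Tendsto (fun i => s i ⌊(q : ℝ)⁻¹ * T i⌋₊ ^ q) l (𝓝 (Real.exp (-1))) := by
    have hsub := hT.sub
      (tendsto_floor_natCast_mul_sub_pow hs hδ (T := T) (by positivity : 0 ≤ (q : ℝ)⁻¹) q)
    rw [sub_zero] at hsub
    refine hsub.congr fun i => ?_
    rw [mul_inv_cancel₀ (Nat.cast_ne_zero.2 hq), one_mul, Nat.floor_natCast, sub_sub_cancel]
  have hroot := hpow.rpow_const (p := (q : ℝ)⁻¹) (Or.inl (Real.exp_pos _).ne')
  rw [← Real.exp_mul, neg_one_mul] at hroot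
  exact hroot.congr fun i => Real.pow_rpow_inv_natCast ((hs i).nonneg _) hq

lemma tendsto_floor_ratCast_mul {r : ℚ} (hr : 0 ≤ r) :
    Tendsto (fun i => s i ⌊(r : ℝ) * T i⌋₊) l (𝓝 (Real.exp (-r))) := by
  lift r to ℚ≥0 using hr
  have hpow := (tendsto_floor_inv_mul hs hδ hT r.den_ne_zero).pow r.num
  have hsum := (tendsto_floor_natCast_mul_sub_pow hs hδ (T := T)
    (by positivity : 0 ≤ (r.den : ℝ)⁻¹) r.num).add hpow
  have hcast : (r.num : ℝ) * (r.den : ℝ)⁻¹ = ((r : ℚ) : ℝ) := by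
    rw [← div_eq_mul_inv, Rat.cast_nnratCast, NNRat.cast_def]
  rw [zero_add, ← Real.exp_nat_mul, mul_neg, hcast] at hsum
  exact hsum.congr fun i => sub_add_cancel _ _

lemma tendsto_floor_mul {t : ℝ} (ht : 0 ≤ t) :
    Tendsto (fun i => s i ⌊t * T i⌋₊) l (𝓝 (Real.exp (-t))) := by
  rcases ht.eq_or_lt with rfl | ht0
  · simp [(hs _).zero, tendsto_const_nhds]
  have hanti (i : ι) : Antitone fun x : ℝ => s i ⌊x * T i⌋₊ := fun a b hab =>
    (hs i).antitone (Nat.floor_le_floor (mul_le_mul_of_nonneg_right hab (Nat.cast_nonneg _)))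
  exact tendsto_of_antitone_of_forall_rat (g := fun x => Real.exp (-x)) hanti (by fun_prop)
    (Ioi_mem_nhds ht0) fun r hr =>
      tendsto_floor_ratCast_mul hs hδ hT (by exact_mod_cast (Set.mem_Ioi.1 hr).le)

end Limit

end AlmostMemoryless

section Mean

lemma floor_mul_eq {T n : ℕ} (hT : 0 < T) {x : ℝ}
    (hx : x ∈ Set.Ico ((n : ℝ) / T) ((n + 1) / T)) : ⌊x * T⌋₊ = n := by
  have hT' : (0 : ℝ) < T := Nat.cast_pos.2 hT
  rw [Nat.floor_eq_iff (mul_nonneg ((by positivity : (0 : ℝ) ≤ n / T).trans hx.1) hT'.le)]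
  exact ⟨(div_le_iff₀ hT').1 hx.1, (lt_div_iff₀ hT').1 hx.2⟩

lemma iUnion_Ico_div_natCast {T : ℕ} (hT : 0 < T) :
    ⋃ n : ℕ, Set.Ico ((n : ℝ) / T) ((n + 1) / T) = Set.Ici 0 := by
  have hT' : (0 : ℝ) < T := Nat.cast_pos.2 hT
  ext x
  simp only [Set.mem_Ici, Set.mem_iUnion, Set.mem_Ico, div_le_iff₀ hT', lt_div_iff₀ hT']
  refine ⟨fun ⟨n, hn, _⟩ => ?_, fun hx => ⟨_, Nat.floor_le (by positivity), Nat.lt_floor_add_one _⟩⟩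
  exact nonneg_of_mul_nonneg_left (n.cast_nonneg.trans hn) hT'

lemma tsum_div_eq_setLIntegral_floor (u : ℕ → ℝ≥0∞) {T : ℕ} (hT : 0 < T) :
    (∑' n, u n) / T = ∫⁻ x in Set.Ioi (0 : ℝ), u ⌊x * T⌋₊ := by
  have hdisj : Pairwise (Function.onFun Disjoint
      fun n : ℕ => Set.Ico ((n : ℝ) / T) ((n + 1) / T)) := fun n k hnk =>
    Set.disjoint_left.2 fun x hn hk => hnk (by rw [← floor_mul_eq hT hn, ← floor_mul_eq hT hk])
  rw [← setLIntegral_congr Ioi_ae_eq_Ici.symm, ← iUnion_Ico_div_natCast hT,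
    lintegral_iUnion (fun n => measurableSet_Ico) hdisj, div_eq_mul_inv, ← ENNReal.tsum_mul_right]
  refine tsum_congr fun n => ?_
  rw [setLIntegral_congr_fun (g := fun _ => u n) measurableSet_Ico
    (fun x hx => by simp only [floor_mul_eq hT hx]), setLIntegral_const, Real.volume_Ico,
    ← sub_div, add_sub_cancel_left, one_div, ENNReal.ofReal_inv_of_pos (Nat.cast_pos.2 hT),
    ENNReal.ofReal_natCast]

lemma floor_mul_le_two_mul_exp {s : ℕ → ℝ} {T : ℕ} (hzero : s 0 = 1) (hanti : Antitone s)
    (hhalf : ∀ n, s (n + (T + T)) ≤ s n * (1 / 2)) {x : ℝ} (hx : 0 ≤ x) :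
    s ⌊x * T⌋₊ ≤ 2 * Real.exp (-(Real.log 2 / 2) * x) := by
  have hpow (j : ℕ) : s (j * (T + T)) ≤ (1 / 2) ^ j := by
    induction j with
    | zero => simp [hzero]
    | succ j ih =>
      rw [Nat.succ_mul, pow_succ]
      exact (hhalf _).trans (mul_le_mul_of_nonneg_right ih (by norm_num))
  have hfloor : ⌊x / 2⌋₊ * (T + T) ≤ ⌊x * T⌋₊ := by
    refine Nat.le_floor ?_
    push_cast
    linarith [mul_le_mul_of_nonneg_right (Nat.floor_le (by positivity : 0 ≤ x / 2))
      (Nat.cast_nonneg (α := ℝ) T)]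
  calc s ⌊x * T⌋₊
      ≤ s (⌊x / 2⌋₊ * (T + T)) := hanti hfloor
    _ ≤ (1 / 2) ^ ⌊x / 2⌋₊ := hpow _
    _ = Real.exp (-(Real.log 2 * ⌊x / 2⌋₊)) := by
        rw [mul_comm, ← mul_neg, Real.exp_nat_mul, Real.exp_neg, Real.exp_log two_pos, one_div]
    _ ≤ Real.exp (Real.log 2 + -(Real.log 2 / 2) * x) := by
        refine Real.exp_le_exp.2 ?_
        linarith [mul_le_mul_of_nonneg_left (Nat.lt_floor_add_one (x / 2)).le
          (Real.log_pos one_lt_two).le]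
    _ = 2 * Real.exp (-(Real.log 2 / 2) * x) := by rw [Real.exp_add, Real.exp_log two_pos]

lemma lintegral_exp_neg_Ioi_zero :
    ∫⁻ x in Set.Ioi (0 : ℝ), ENNReal.ofReal (Real.exp (-x)) = 1 := by
  rw [← ofReal_integral_eq_lintegral_ofReal (integrableOn_exp_neg_Ioi 0)
    (ae_of_all _ fun x => (Real.exp_pos _).le), integral_exp_neg_Ioi_zero, ENNReal.ofReal_one]

variable {ι : Type*} {l : Filter ι} [l.IsCountablyGenerated] {s : ι → ℕ → ℝ} {T : ι → ℕ}

lemma tendsto_tsum_div (hzero : ∀ i, s i 0 = 1) (hanti : ∀ i, Antitone (s i))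
    (hT : ∀ i, 0 < T i) (hhalf : ∀ᶠ i in l, ∀ n, s i (n + (T i + T i)) ≤ s i n * (1 / 2))
    (hexp : ∀ t : ℝ, 0 ≤ t → Tendsto (fun i => s i ⌊t * T i⌋₊) l (𝓝 (Real.exp (-t)))) :
    Tendsto (fun i => (∑' n, ENNReal.ofReal (s i n)) / (T i : ℝ≥0∞)) l (𝓝 1) := by
  have hint : IntegrableOn (fun x => 2 * Real.exp (-(Real.log 2 / 2) * x)) (Set.Ioi (0 : ℝ)) :=
    (exp_neg_integrableOn_Ioi 0 (by positivity)).const_mul 2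
  simp only [tsum_div_eq_setLIntegral_floor _ (hT _), ← lintegral_exp_neg_Ioi_zero]
  refine tendsto_lintegral_filter_of_dominated_convergence
    (fun x => ENNReal.ofReal (2 * Real.exp (-(Real.log 2 / 2) * x))) ?_ ?_
    (hasFiniteIntegral_iff_ofReal (ae_of_all _ fun x => by positivity) |>.1 hint.2).ne ?_
  · exact Eventually.of_forall fun i => (measurable_from_nat
      (f := fun n => ENNReal.ofReal (s i n))).comp (Nat.measurable_floor.comp (by fun_prop))
  · filter_upwards [hhalf] with i hi
    filter_upwards [ae_restrict_mem measurableSet_Ioi] with x hx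
    exact ENNReal.ofReal_le_ofReal
      (floor_mul_le_two_mul_exp (hzero i) (hanti i) hi (Set.mem_Ioi.1 hx).le)
  · filter_upwards [ae_restrict_mem measurableSet_Ioi] with x hx
    exact (ENNReal.continuous_ofReal.tendsto _).comp (hexp x (Set.mem_Ioi.1 hx).le)

end Mean

lemma AlmostMemoryless.tendsto_of_isLeast {ι : Type*} {l : Filter ι} {s : ι → ℕ → ℝ} {T : ι → ℕ}
    {δ : ι → ℝ} (hs : ∀ i, AlmostMemoryless (δ i) (s i)) (hδ : Tendsto δ l (𝓝 0)) {c : ℝ}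
    (hc : c < 1) (hT : ∀ i, IsLeast {n | s i n ≤ c} (T i)) :
    Tendsto (fun i => s i (T i)) l (𝓝 c) := by
  have hlower : Tendsto (fun i => c - 2 * δ i) l (𝓝 c) := by
    simpa using (hδ.const_mul 2).const_sub c
  refine tendsto_of_tendsto_of_tendsto_of_le_of_le hlower tendsto_const_nhds (fun i => ?_)
    fun i => (hT i).1
  obtain ⟨n, hn⟩ : ∃ n, T i = n + 1 := by
    refine Nat.exists_eq_succ_of_ne_zero fun hzero => hc.not_ge ?_
    simpa [hzero, (hs i).zero] using (hT i).1
  have hpred : c < s i n := not_le.1 fun hle => by have := (hT i).2 hle; lia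
  have hjump := (hs i).sub_succ_le n
  simp only [hn]
  linarith

section Chain

open Matrix

variable {X : Type*} [Fintype X] [DecidableEq X] {m s : X}

section Single

variable {P : Matrix X X ℝ} (hP : P ∈ rowStochastic ℝ X) {R : ℕ} {ε : ℝ}
  (hε : ∀ x, survival P {m, s} R x ≤ ε)
include hP hε

lemma abs_survival_add_sub_mul_le (n k : ℕ) :
    |survival P {s} (n + k) m - survival P {s} n m * survival P {s} k m|
      ≤ 2 * (ε + (1 - survival P {s} (R + R) m)) := by
  have hnonneg (n : ℕ) : 0 ≤ survival P {s} n m := survival_nonneg hP.1 n m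
  have hle_one (n : ℕ) : survival P {s} n m ≤ 1 := survival_le_one hP n m
  have hanti := survival_antitone hP (B := {s}) m
  have hε_nonneg : 0 ≤ ε := (survival_nonneg hP.1 R m).trans (hε m)
  have hexit := hle_one (R + R)
  refine abs_le.2 ⟨?_, ?_⟩
  · have hmul := survival_mul_sub_le hP hε n k
    have hdrop := survival_sub_survival_add_le hP hε n
    have hεn := mul_le_of_le_one_right hε_nonneg (hle_one n)
    have hloss : survival P {s} n m - (survival P {s} (n + R) m - ε * survival P {s} n m)
        ≤ 2 * (ε + (1 - survival P {s} (R + R) m)) := by linarith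
    have := (mul_le_mul_of_nonneg_left hloss (hnonneg k)).trans
      (mul_le_of_le_one_left (by linarith) (hle_one k))
    linarith
  · rcases le_total k R with hk | hk
    · have hbefore : survival P {s} (R + R) m ≤ survival P {s} k m := hanti (by lia)
      have hn := mul_le_of_le_one_left (sub_nonneg.2 (hle_one k)) (hle_one n)
      have : survival P {s} (n + k) m ≤ survival P {s} n m := hanti (by lia)
      linarith
    · obtain ⟨k, rfl⟩ := Nat.exists_eq_add_of_le hk
      have hmul := survival_add_le_mul hP hε n k
      have hdrop := survival_sub_survival_add_le hP hε k
      rw [add_comm k R] at hdrop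
      have hloss : survival P {s} k m + ε - survival P {s} (R + k) m
          ≤ 2 * (ε + (1 - survival P {s} (R + R) m)) := by linarith
      have := (mul_le_mul_of_nonneg_left hloss (hnonneg n)).trans
        (mul_le_of_le_one_left (by linarith) (hle_one n))
      linarith

lemma almostMemoryless_survival (hms : m ≠ s) (hR : 0 < R) :
    AlmostMemoryless (2 * (ε + (1 - survival P {s} (R + R) m))) fun n => survival P {s} n m where
  zero := survival_zero hms
  antitone := survival_antitone hP m
  nonneg n := survival_nonneg hP.1 n m
  abs_add_sub_mul_le := abs_survival_add_sub_mul_le hP hε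
  one_sub_one_le := by
    have hε_nonneg : 0 ≤ ε := (survival_nonneg hP.1 R m).trans (hε m)
    have hanti : survival P {s} (R + R) m ≤ survival P {s} 1 m := survival_antitone hP m (by lia)
    linarith [survival_le_one hP (B := {s}) (R + R) m]

lemma survival_add_le_half {T : ℕ} (hT : survival P {s} T m ≤ Real.exp (-1))
    (hexit : Real.exp (-1) < survival P {s} (R + R) m) (hε_le : ε ≤ 1 / 10) (n : ℕ) :
    survival P {s} (n + (T + T)) m ≤ survival P {s} n m * (1 / 2) := by
  have hanti := survival_antitone hP (B := {s}) m
  have hRT : R ≤ T := by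
    by_contra! hlt
    exact (hT.trans_lt hexit).not_ge (hanti (by lia))
  calc survival P {s} (n + (T + T)) m
      ≤ survival P {s} (n + (R + T)) m := hanti (by lia)
    _ ≤ survival P {s} n m * (survival P {s} T m + ε) := survival_add_le_mul hP hε n T
    _ ≤ survival P {s} n m * (1 / 2) := by
        refine mul_le_mul_of_nonneg_left ?_ (survival_nonneg hP.1 n m)
        have he : Real.exp (-1) < 4 / 10 := Real.exp_neg_one_lt_d9.trans (by norm_num)
        linarith

end Single

variable {ι : Type*} {l : Filter ι} {P : ι → Matrix X X ℝ} {R : ι → ℕ} {ε : ι → ℝ} {T : ι → ℕ}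
  (hP : ∀ i, P i ∈ rowStochastic ℝ X) (hms : m ≠ s) (hR : ∀ i, 0 < R i)
  (hε : ∀ i x, survival (P i) {m, s} (R i) x ≤ ε i) (hε_lim : Tendsto ε l (𝓝 0))
  (hexit : Tendsto (fun i => survival (P i) {s} (R i + R i) m) l (𝓝 1))
  (hT : ∀ i, IsLeast {n | survival (P i) {s} n m ≤ Real.exp (-1)} (T i))
include hP hms hR hε hε_lim hexit hT

theorem tendsto_survival_floor_mul {t : ℝ} (ht : 0 ≤ t) :
    Tendsto (fun i => survival (P i) {s} ⌊t * T i⌋₊ m) l (𝓝 (Real.exp (-t))) := by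
  have hs (i : ι) := almostMemoryless_survival (hP i) (hε i) hms (hR i)
  have hδ : Tendsto (fun i => 2 * (ε i + (1 - survival (P i) {s} (R i + R i) m))) l (𝓝 0) := by
    simpa using (hε_lim.add (hexit.const_sub 1)).const_mul 2
  exact AlmostMemoryless.tendsto_floor_mul hs hδ
    (AlmostMemoryless.tendsto_of_isLeast hs hδ (Real.exp_lt_one_iff.2 neg_one_lt_zero) hT) ht

theorem tendsto_tsum_survival_div [l.IsCountablyGenerated] :
    Tendsto (fun i => (∑' n, ENNReal.ofReal (survival (P i) {s} n m)) / (T i : ℝ≥0∞)) l (𝓝 1) := by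
  have hzero (i : ι) : survival (P i) {s} 0 m = 1 := survival_zero hms
  have hT_pos (i : ι) : 0 < T i := by
    refine Nat.pos_of_ne_zero fun hTi => (Real.exp_lt_one_iff.2 neg_one_lt_zero).not_ge ?_
    have hle : survival (P i) {s} (T i) m ≤ Real.exp (-1) := (hT i).1
    rwa [hTi, hzero] at hle
  refine tendsto_tsum_div hzero (fun i => survival_antitone (hP i) m) hT_pos ?_
    fun t ht => tendsto_survival_floor_mul hP hms hR hε hε_lim hexit hT ht
  filter_upwards [hexit.eventually (lt_mem_nhds (Real.exp_lt_one_iff.2 neg_one_lt_zero)),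
    hε_lim.eventually (ge_mem_nhds (by norm_num : (0 : ℝ) < 1 / 10))] with i hi hεi
  exact survival_add_le_half (hP i) (hε i) (hT i).1 hi hεi

end Chain

/-! ### Metropolis dynamics -/

section Conductance

variable {X : Type*}

lemma exists_nat_abs_sub_le_of_reflTransGen {r : X → X → Prop} {x y : X}
    (H : Relation.ReflTransGen r x y) :
    ∃ n : ℕ, ∀ (f : X → ℝ) (c : ℝ), (∀ a b, r a b → |f a - f b| ≤ c) → |f x - f y| ≤ n * c := by
  induction H with
  | refl => exact ⟨0, fun f c _ => by simp⟩
  | @tail y z _ hyz ih =>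
    obtain ⟨n, hn⟩ := ih
    refine ⟨n + 1, fun f c hf => ?_⟩
    push_cast
    linarith [abs_sub_le (f x) (f y) (f z), hn f c hf, hf y z hyz]

variable [Fintype X] {P : Matrix X X ℝ} {μ : X → ℝ}

lemma dirichletForm_nonneg (hμP : ∀ x y, 0 ≤ μ x * P x y) (f : X → ℝ) :
    0 ≤ dirichletForm μ P f :=
  div_nonneg (Finset.sum_nonneg fun x _ => Finset.sum_nonneg fun y _ =>
    mul_nonneg (hμP x y) (sq_nonneg _)) zero_le_two

lemma mul_sub_sq_le_two_mul_dirichletForm (hμP : ∀ x y, 0 ≤ μ x * P x y) (f : X → ℝ) (x y : X) :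
    μ x * P x y * (f x - f y) ^ 2 ≤ 2 * dirichletForm μ P f := by
  have hterm (x y : X) : 0 ≤ μ x * P x y * (f x - f y) ^ 2 := mul_nonneg (hμP x y) (sq_nonneg _)
  calc μ x * P x y * (f x - f y) ^ 2
      ≤ ∑ z, μ x * P x z * (f x - f z) ^ 2 :=
        Finset.single_le_sum (fun z _ => hterm x z) (Finset.mem_univ y)
    _ ≤ ∑ w, ∑ z, μ w * P w z * (f w - f z) ^ 2 :=
        Finset.single_le_sum (f := fun w => ∑ z, μ w * P w z * (f w - f z) ^ 2)
          (fun w _ => Finset.sum_nonneg fun z _ => hterm w z) (Finset.mem_univ x)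
    _ = 2 * dirichletForm μ P f := by
        rw [dirichletForm]
        ring

end Conductance

section Wells

variable {L : ℕ} [NeZero L] {J h : ℝ}

lemma exists_reach_const (hL : 2 ≤ L) (hh : 0 < h) (hhJ : h < J) (σ : Config L) :
    ∃ η ∈ ({allMinus L, allPlus L} : Set (Config L)), Reach J h (energy J h σ + 2 * J) σ η := by
  have wf := wellFounded_better (L := L) J h
  induction σ using wf.induction with
  | _ σ ih =>
    by_cases hσ : IsTrap J h σ
    · exact ⟨σ, hσ.eq_allMinus_or_eq_allPlus hL hh hhJ, .refl⟩
    · simp only [IsTrap, not_forall, not_not] at hσ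
      obtain ⟨η, hση, hbetter⟩ := hσ
      obtain ⟨ζ, hζ, hηζ⟩ := ih η hbetter
      have henergy : energy J h η ≤ energy J h σ := hbetter.elim le_of_lt And.left
      exact ⟨ζ, hζ, hση.trans (hηζ.mono (by linarith))⟩

lemma reach_allPlus {c : ℝ} (hc : ∀ σ : Config L, energy J h σ ≤ c) (σ : Config L) :
    Reach J h c σ (allPlus L) := by
  suffices H : ∀ S : Finset (Site L), Reach J h c σ (S.piecewise (allPlus L) σ) by
    simpa using H Finset.univ
  intro S
  induction S using Finset.induction_on with
  | empty =>
    rw [Finset.piecewise_empty]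
    exact .refl
  | insert x S _ ih =>
    rw [Finset.piecewise_insert]
    set η := S.piecewise (allPlus L) σ
    rcases Int.units_eq_one_or (η x) with hηx | hηx
    · rwa [allPlus, ← hηx, Function.update_eq_self]
    · exact ih.tail ⟨⟨x, flip_eq_update hηx⟩, hc _, hc _⟩

lemma exists_forall_reach_allPlus (J h : ℝ) : ∃ V, ∀ σ : Config L,
    ∃ η ∈ ({allPlus L} : Set (Config L)), Reach J h (energy J h σ + V) σ η := by
  obtain ⟨M, hM⟩ := (Set.finite_range (energy (L := L) J h)).bddAbove
  obtain ⟨m, hm⟩ := (Set.finite_range (energy (L := L) J h)).bddBelow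
  refine ⟨M - m, fun σ => ⟨allPlus L, rfl, (reach_allPlus (fun η => hM ⟨η, rfl⟩) σ).mono ?_⟩⟩
  linarith [hm ⟨σ, rfl⟩]

end Wells

section Metropolis

open Matrix

variable {L : ℕ} [NeZero L]

lemma transProb_mem_rowStochastic (J h : ℝ) (β : ℝ≥0) :
    transProb J h β ∈ rowStochastic ℝ (Config L) :=
  mem_rowStochastic_iff_sum.2 ⟨transProb_nonneg J h β, sum_transProb J h β⟩

/-- The Boltzmann weight, for which the Metropolis dynamics is reversible. -/
noncomputable def weight (J h : ℝ) (β : ℝ≥0) (σ : Config L) : ℝ := Real.exp (-(β * energy J h σ))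

lemma weight_pos (J h : ℝ) (β : ℝ≥0) (σ : Config L) : 0 < weight J h β σ := Real.exp_pos _

lemma weight_mul_transProb_of_ne (J h : ℝ) (β : ℝ≥0) {σ η : Config L} (hne : η ≠ σ) :
    weight J h β σ * transProb J h β σ η
      = connectivity σ η * Real.exp (-(β * max (energy J h σ) (energy J h η))) := by
  have hmax : max (energy J h σ) (energy J h η)
      = energy J h σ + max (energy J h η - energy J h σ) 0 := by
    rw [max_comm, ← max_add_add_left, add_sub_cancel, add_zero]
  rw [transProb, if_neg hne, jumpProb, weight, mul_left_comm, ← Real.exp_add, hmax]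
  ring_nf

lemma weight_mul_transProb_nonneg (J h : ℝ) (β : ℝ≥0) (σ η : Config L) :
    0 ≤ weight J h β σ * transProb J h β σ η :=
  mul_nonneg (weight_pos J h β σ).le (transProb_nonneg J h β σ η)

lemma connectivity_comm (σ η : Config L) : connectivity σ η = connectivity η σ := by
  have hsymm : (∃ x, flip σ x = η) ↔ ∃ x, flip η x = σ := by
    constructor <;> rintro ⟨x, rfl⟩ <;> exact ⟨x, flip_flip _ x⟩
  simp only [connectivity, hsymm]

lemma weight_mul_transProb_comm (J h : ℝ) (β : ℝ≥0) (σ η : Config L) :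
    weight J h β σ * transProb J h β σ η = weight J h β η * transProb J h β η σ := by
  rcases eq_or_ne η σ with rfl | hne
  · rfl
  · rw [weight_mul_transProb_of_ne J h β hne, weight_mul_transProb_of_ne J h β hne.symm,
      connectivity_comm, max_comm]

variable {J h V : ℝ} {B : Set (Config L)}

lemma FlipBelow.exp_le {c : ℝ} {σ η : Config L} (H : FlipBelow J h c σ η) (β : ℝ≥0) :
    Real.exp (-(β * c)) ≤ Fintype.card (Site L) * (weight J h β σ * transProb J h β σ η) := by
  obtain ⟨⟨x, rfl⟩, hσ, hη⟩ := H
  have : Nonempty (Site L) := ⟨x⟩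
  rw [weight_mul_transProb_of_ne J h β (flip_ne σ x), connectivity, if_pos ⟨x, rfl⟩, ← mul_assoc,
    mul_one_div_cancel (Nat.cast_ne_zero.2 Fintype.card_ne_zero), one_mul]
  exact Real.exp_le_exp.2 (neg_le_neg (mul_le_mul_of_nonneg_left (max_le hσ hη) β.coe_nonneg))

lemma FlipBelow.abs_sub_le {c : ℝ} {σ η : Config L} (H : FlipBelow J h c σ η) (β : ℝ≥0)
    (f : Config L → ℝ) :
    |f σ - f η| ≤ √(2 * Fintype.card (Site L) * Real.exp (β * c)
      * dirichletForm (weight J h β) (transProb J h β) f) := by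
  have hdirichlet := mul_sub_sq_le_two_mul_dirichletForm (P := transProb J h β)
    (weight_mul_transProb_nonneg J h β) f σ η
  refine Real.abs_le_sqrt ?_
  calc (f σ - f η) ^ 2
      = Real.exp (β * c) * (Real.exp (-(β * c)) * (f σ - f η) ^ 2) := by
        rw [← mul_assoc, ← Real.exp_add, add_neg_cancel, Real.exp_zero, one_mul]
    _ ≤ Real.exp (β * c) * (Fintype.card (Site L) * (weight J h β σ * transProb J h β σ η)
          * (f σ - f η) ^ 2) := by
        gcongr
        exact H.exp_le β
    _ = Real.exp (β * c) * Fintype.card (Site L)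
          * (weight J h β σ * transProb J h β σ η * (f σ - f η) ^ 2) := by ring
    _ ≤ Real.exp (β * c) * Fintype.card (Site L)
          * (2 * dirichletForm (weight J h β) (transProb J h β) f) := by gcongr
    _ = _ := by ring

lemma exists_poincare (hB : ∀ σ, ∃ η ∈ B, Reach J h (energy J h σ + V) σ η) :
    ∃ K : ℝ, 0 < K ∧ ∀ (β : ℝ≥0) (f : Config L → ℝ), (∀ σ ∈ B, f σ = 0) →
      ∑ σ, weight J h β σ * f σ ^ 2
        ≤ K * Real.exp (β * V) * dirichletForm (weight J h β) (transProb J h β) f := by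
  choose b hbB hb using hB
  choose n hn using fun σ => exists_nat_abs_sub_le_of_reflTransGen (hb σ)
  refine ⟨1 + ∑ σ, (n σ : ℝ) ^ 2 * (2 * Fintype.card (Site L)), by positivity, fun β f hf => ?_⟩
  set D := dirichletForm (weight J h β) (transProb J h β) f
  have hD : 0 ≤ D := dirichletForm_nonneg (weight_mul_transProb_nonneg J h β) f
  have hσ (σ : Config L) : weight J h β σ * f σ ^ 2
      ≤ (n σ : ℝ) ^ 2 * (2 * Fintype.card (Site L)) * (Real.exp (β * V) * D) := by
    have habs := hn σ f _ fun _ _ H => H.abs_sub_le β f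
    rw [hf _ (hbB σ), sub_zero] at habs
    calc weight J h β σ * f σ ^ 2
        ≤ weight J h β σ * (n σ * √(2 * Fintype.card (Site L)
            * Real.exp (β * (energy J h σ + V)) * D)) ^ 2 :=
          mul_le_mul_of_nonneg_left (sq_le_sq.2 (habs.trans (le_abs_self _)))
            (weight_pos J h β σ).le
      _ = (n σ : ℝ) ^ 2 * (2 * Fintype.card (Site L))
            * (weight J h β σ * Real.exp (β * (energy J h σ + V)) * D) := by
          rw [mul_pow, Real.sq_sqrt (by positivity)]
          ring
      _ = (n σ : ℝ) ^ 2 * (2 * Fintype.card (Site L)) * (Real.exp (β * V) * D) := by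
          rw [weight, ← Real.exp_add]
          ring_nf
  calc ∑ σ, weight J h β σ * f σ ^ 2
      ≤ ∑ σ, (n σ : ℝ) ^ 2 * (2 * Fintype.card (Site L)) * (Real.exp (β * V) * D) :=
        Finset.sum_le_sum fun σ _ => hσ σ
    _ ≤ (1 + ∑ σ, (n σ : ℝ) ^ 2 * (2 * Fintype.card (Site L))) * Real.exp (β * V) * D := by
        rw [← Finset.sum_mul, add_mul, add_mul, one_mul, ← mul_assoc]
        exact le_add_of_nonneg_left (by positivity)

lemma exists_survival_le (hB : ∀ σ, ∃ η ∈ B, Reach J h (energy J h σ + V) σ η) :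
    ∃ K W : ℝ, 0 < K ∧ ∀ (β : ℝ≥0) (n : ℕ) (σ : Config L),
      survival (transProb J h β) B (2 * n) σ
        ≤ Fintype.card (Config L) * Real.exp (β * W - n / (K * Real.exp (β * V))) := by
  obtain ⟨K, hK, hpoincare⟩ := exists_poincare hB
  obtain ⟨W, hW⟩ := (Set.finite_range fun p : Config L × Config L =>
    energy J h p.1 - energy J h p.2).bddAbove
  refine ⟨K, W, hK, fun β n σ => (survival_two_mul_le (transProb_mem_rowStochastic J h β)
    (weight_mul_transProb_comm J h β) (weight_pos J h β)
    (by positivity) (hpoincare β) n σ).trans ?_⟩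
  have hratio (η : Config L) : weight J h β η / weight J h β σ ≤ Real.exp (β * W) := by
    rw [weight, weight, ← Real.exp_sub, neg_sub_neg, ← mul_sub]
    exact Real.exp_le_exp.2 (mul_le_mul_of_nonneg_left (hW ⟨(σ, η), rfl⟩) β.coe_nonneg)
  have hsum := Finset.sum_le_card_nsmul Finset.univ _ _ fun η _ => hratio η
  rw [← Finset.sum_div, Finset.card_univ, nsmul_eq_mul] at hsum
  rw [sub_eq_add_neg, Real.exp_add, ← mul_assoc]
  exact mul_le_mul_of_nonneg_right hsum (Real.exp_pos _).le

lemma energy_flip_allMinus (hL : 2 ≤ L) (J h : ℝ) (x : Site L) :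
    energy J h (flip (allMinus L) x) = energy J h (allMinus L) + (3 * J - h) := by
  classical
  have hspin : spin (allMinus L) = fun _ => -1 := by ext; simp [spin, allMinus]
  rw [energy_flip, hspin, Finset.sum_const, SimpleGraph.card_neighborFinset_eq_degree,
    hexTorus_isRegularOfDegree hL x]
  ring

lemma one_sub_transProb_allMinus_le (hL : 2 ≤ L) (hJ : h ≤ 3 * J) (β : ℝ≥0) :
    1 - transProb J h β (allMinus L) (allMinus L) ≤ Real.exp (-(β * (3 * J - h))) := by
  have hjump (ζ : Config L) : jumpProb J h β (allMinus L) ζ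
      = jumpProb J h 0 (allMinus L) ζ * Real.exp (-(β * (3 * J - h))) := by
    by_cases hζ : ∃ x, flip (allMinus L) x = ζ
    · obtain ⟨x, rfl⟩ := hζ
      rw [jumpProb, jumpProb, energy_flip_allMinus hL, add_sub_cancel_left,
        max_eq_left (by linarith)]
      simp
    · simp [jumpProb, connectivity, hζ]
  rw [transProb, if_pos rfl, sub_sub_cancel, Finset.sum_congr rfl fun ζ _ => hjump ζ,
    ← Finset.sum_mul]
  exact mul_le_of_le_one_left (Real.exp_pos _).le (sum_jumpProb_le_one J h 0 (allMinus L))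

end Metropolis

/-! ### Hitting times -/

section MarkovLaw

open Preorder

variable {X : Type*} [MeasurableSpace X]

/-- The law of the trajectory of the time-homogeneous Markov chain with transition kernel `κ`
started from `x`. -/
noncomputable def markovLaw (κ : Kernel X X) [IsMarkovKernel κ] (x : X) : Measure (ℕ → X) :=
  Kernel.trajMeasure (X := fun _ => X) (Measure.dirac x) fun n =>
    κ.comap (fun y => y ⟨n, Finset.mem_Iic.2 le_rfl⟩) (measurable_pi_apply _)

variable (κ : Kernel X X) [IsMarkovKernel κ] (x : X)

instance : IsProbabilityMeasure (markovLaw κ x) := by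
  unfold markovLaw
  infer_instance

lemma map_eval_zero_markovLaw : (markovLaw κ x).map (fun ω => ω 0) = Measure.dirac x := by
  have hrestrict : (markovLaw κ x).map (frestrictLe (π := fun _ => X) 0)
      = Measure.dirac fun _ => x := by
    rw [markovLaw, Kernel.trajMeasure, Measure.map_comp _ _ (by fun_prop),
      Kernel.traj_map_frestrictLe, Kernel.partialTraj_self, Measure.id_comp,
      Measure.map_dirac' (by fun_prop)]
    rfl
  calc (markovLaw κ x).map (fun ω => ω 0)
      = ((markovLaw κ x).map (frestrictLe (π := fun _ => X) 0)).map
          (fun y => y ⟨0, Finset.mem_Iic.2 le_rfl⟩) := by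
        rw [Measure.map_map (by fun_prop) (by fun_prop)]
        rfl
    _ = Measure.dirac x := by rw [hrestrict, Measure.map_dirac' (by fun_prop)]

lemma ae_markovLaw_eval_zero_eq [MeasurableSingletonClass X] :
    ∀ᵐ ω ∂markovLaw κ x, ω 0 = x := by
  have hdirac : ∀ᵐ y ∂(markovLaw κ x).map (fun ω => ω 0), y = x := by
    rw [map_eval_zero_markovLaw, ae_dirac_eq]
    rfl
  exact ae_of_ae_map (measurable_pi_apply 0).aemeasurable hdirac

lemma setLIntegral_eval_succ_markovLaw (n : ℕ) {S : Set (Π _ : Finset.Iic n, X)}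
    (hS : MeasurableSet S) {f : X → ℝ≥0∞} (hf : Measurable f) :
    ∫⁻ ω in frestrictLe n ⁻¹' S, f (ω (n + 1)) ∂markovLaw κ x
      = ∫⁻ ω in frestrictLe n ⁻¹' S, ∫⁻ y, f y ∂κ (ω n) ∂markovLaw κ x := by
  have key := Kernel.map_frestrictLe_trajMeasure_compProd_eq_map_trajMeasure
    (X := fun _ => X) (μ₀ := Measure.dirac x)
    (κ := fun n => κ.comap (fun y => y ⟨n, Finset.mem_Iic.2 le_rfl⟩) (measurable_pi_apply _))
    (a := n)
  have hint := congrArg (fun ν => ∫⁻ p in S ×ˢ Set.univ, f p.2 ∂ν) key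
  rw [Measure.setLIntegral_compProd (by fun_prop) hS .univ,
    setLIntegral_map (hS.prod .univ) (by fun_prop) (by fun_prop)] at hint
  simp only [Measure.restrict_univ, Kernel.comap_apply] at hint
  rw [setLIntegral_map hS (by fun_prop) (by fun_prop)] at hint
  rw [Set.prod_univ] at hint
  exact hint.symm

end MarkovLaw

section Survival

variable {X : Type*} [Fintype X] [MeasurableSpace X] [MeasurableSingletonClass X]
  {κ : Kernel X X} {P : Matrix X X ℝ} (hP : ∀ x y, 0 ≤ P x y)
  (hκ : ∀ x y, κ x {y} = ENNReal.ofReal (P x y)) {A : Set X}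
include hP hκ

lemma lintegral_ofReal_survival (n : ℕ) {x : X} (hx : x ∉ A) :
    ∫⁻ y, ENNReal.ofReal (survival P A n y) ∂κ x = ENNReal.ofReal (survival P A (n + 1) x) := by
  rw [lintegral_fintype, survival_succ n hx, ENNReal.ofReal_sum_of_nonneg fun y _ =>
    mul_nonneg (hP x y) (survival_nonneg hP n y)]
  refine Finset.sum_congr rfl fun y _ => ?_
  rw [hκ, mul_comm, ENNReal.ofReal_mul (hP x y)]

variable [IsMarkovKernel κ]

lemma setLIntegral_survival_markovLaw (x : X) (n k : ℕ) :
    ∫⁻ ω in {ω | ∀ i ≤ n, ω i ∉ A}, ENNReal.ofReal (survival P A k (ω n)) ∂markovLaw κ x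
      = markovLaw κ x {ω | ∀ i ≤ n + k, ω i ∉ A} := by
  have hmeas (n : ℕ) : MeasurableSet {ω : ℕ → X | ∀ i ≤ n, ω i ∉ A} := by measurability
  induction k generalizing n with
  | zero =>
    rw [setLIntegral_congr_fun (g := 1) (hmeas n) fun ω hω => by
      simp [survival_zero (hω n le_rfl)]]
    simp
  | succ k ih =>
    calc ∫⁻ ω in {ω | ∀ i ≤ n, ω i ∉ A}, ENNReal.ofReal (survival P A (k + 1) (ω n)) ∂markovLaw κ x
        = ∫⁻ ω in {ω | ∀ i ≤ n, ω i ∉ A}, ∫⁻ y, ENNReal.ofReal (survival P A k y) ∂κ (ω n)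
            ∂markovLaw κ x :=
          setLIntegral_congr_fun (hmeas n) fun ω hω =>
            (lintegral_ofReal_survival hP hκ k (hω n le_rfl)).symm
      _ = ∫⁻ ω in {ω | ∀ i ≤ n, ω i ∉ A}, ENNReal.ofReal (survival P A k (ω (n + 1)))
            ∂markovLaw κ x := by
          have hpre : {ω : ℕ → X | ∀ i ≤ n, ω i ∉ A}
              = Preorder.frestrictLe n ⁻¹' {y : Finset.Iic n → X | ∀ i, y i ∉ A} := by
            ext ω
            simp
          rw [hpre]
          exact (setLIntegral_eval_succ_markovLaw κ x n (by measurability) (by fun_prop)).symm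
      _ = ∫⁻ ω in {ω | ∀ i ≤ n + 1, ω i ∉ A}, ENNReal.ofReal (survival P A k (ω (n + 1)))
            ∂markovLaw κ x := by
          rw [← lintegral_indicator (hmeas n), ← lintegral_indicator (hmeas (n + 1))]
          classical
          refine lintegral_congr fun ω => ?_
          by_cases hω : ω (n + 1) ∈ A
          · simp [Set.indicator_apply, survival_of_mem k hω]
          · simp [Set.indicator_apply, Nat.le_add_one_iff, or_imp, forall_and, hω]
      _ = markovLaw κ x {ω | ∀ i ≤ n + (k + 1), ω i ∉ A} := by
          rw [ih, Nat.add_right_comm, Nat.add_assoc]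

lemma markovLaw_avoid (x : X) (n : ℕ) :
    markovLaw κ x {ω | ∀ i ≤ n, ω i ∉ A} = ENNReal.ofReal (survival P A n x) := by
  have key := setLIntegral_survival_markovLaw hP hκ x 0 n (A := A)
  have hzero : {ω : ℕ → X | ∀ i ≤ 0, ω i ∉ A} = (fun ω => ω 0) ⁻¹' Aᶜ := by
    ext ω
    simp
  rw [zero_add, hzero, ← setLIntegral_map (f := fun y => ENNReal.ofReal (survival P A n y))
    (by measurability) (by measurability) (by fun_prop), map_eval_zero_markovLaw] at key
  classical
  rw [← key, setLIntegral_dirac]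
  split_ifs with hx
  · rfl
  · rw [survival_of_mem n (not_not.1 hx), ENNReal.ofReal_zero]

end Survival

section HittingTime

variable {L : ℕ} {A : Set (Config L)}

lemma lt_hitTime_iff (n : ℕ) (X : ℕ → Config L) :
    (n : ℕ∞) < hitTime A X ↔ ∀ i, 1 ≤ i → i ≤ n → X i ∉ A := by
  have hle : hitTime A X ≤ n ↔ ∃ i ∈ Set.Icc 1 n, X i ∈ A := hittingAfter_le_iff
  rw [← not_le, hle]
  simp only [Set.mem_Icc, not_exists, not_and, and_imp]

lemma measurableSet_lt_hitTime [NeZero L] (n : ℕ) :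
    MeasurableSet {X : ℕ → Config L | (n : ℕ∞) < hitTime A X} := by
  have hinter : {X : ℕ → Config L | (n : ℕ∞) < hitTime A X}
      = ⋂ i ∈ Finset.Icc 1 n, (fun X => X i) ⁻¹' Aᶜ := by
    ext X
    simp [lt_hitTime_iff]
  rw [hinter]
  exact Finset.measurableSet_biInter _ fun i _ =>
    measurable_pi_apply i A.to_countable.measurableSet.compl

variable [NeZero L] (J h : ℝ) (β : ℝ≥0) {σ : Config L}

lemma stepKernel_apply_singleton (σ η : Config L) :
    stepKernel J h β σ {η} = ENNReal.ofReal (transProb J h β σ η) :=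
  PMF.toMeasure_apply_singleton (stepPMF J h β σ) η (measurableSet_singleton η)

instance : IsProbabilityMeasure (chainLaw J h β σ) :=
  inferInstanceAs (IsProbabilityMeasure (markovLaw (stepKernel J h β) σ))

lemma chainLaw_lt_hitTime (hσ : σ ∉ A) (n : ℕ) :
    chainLaw J h β σ {X | (n : ℕ∞) < hitTime A X}
      = ENNReal.ofReal (survival (transProb J h β) A n σ) := by
  rw [← markovLaw_avoid (transProb_nonneg J h β) (stepKernel_apply_singleton J h β) σ n]
  refine measure_congr ?_
  filter_upwards [ae_markovLaw_eval_zero_eq (stepKernel J h β) σ] with X hX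
  refine propext ((lt_hitTime_iff n X).trans ⟨fun H i hi => ?_, fun H i _ hi => H i hi⟩)
  rcases i.eq_zero_or_pos with rfl | hpos
  · rwa [hX]
  · exact H i hpos hi

lemma chainLaw_real_lt_hitTime (hσ : σ ∉ A) (n : ℕ) :
    (chainLaw J h β σ).real {X | (n : ℕ∞) < hitTime A X}
      = survival (transProb J h β) A n σ := by
  rw [measureReal_def, chainLaw_lt_hitTime J h β hσ,
    ENNReal.toReal_ofReal (survival_nonneg (transProb_nonneg J h β) n σ)]

lemma chainLaw_real_hitTime_le (hσ : σ ∉ A) (n : ℕ) :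
    (chainLaw J h β σ).real {X | hitTime A X ≤ n} = 1 - survival (transProb J h β) A n σ := by
  rw [← chainLaw_real_lt_hitTime J h β hσ n,
    ← probReal_compl_eq_one_sub (measurableSet_lt_hitTime n)]
  congr 1
  ext X
  simp

lemma toENNReal_eq_tsum_indicator (N : ℕ∞) :
    (N : ℝ≥0∞) = ∑' n : ℕ, {n : ℕ | (n : ℕ∞) < N}.indicator 1 n := by
  rw [← tsum_subtype]
  refine .trans ?_ (ENNReal.tsum_set_one _).symm
  congr 1
  induction N using ENat.recTopCoe with
  | top => simp
  | coe N => simpa [Set.Iio_def] using (Set.encard_coe_eq_coe_finsetCard (Finset.range N)).symm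

lemma lintegral_hitTime (hσ : σ ∉ A) :
    ∫⁻ X, (hitTime A X : ℝ≥0∞) ∂chainLaw J h β σ
      = ∑' n, ENNReal.ofReal (survival (transProb J h β) A n σ) := by
  calc ∫⁻ X, (hitTime A X : ℝ≥0∞) ∂chainLaw J h β σ
      = ∫⁻ X, ∑' n : ℕ, {X | (n : ℕ∞) < hitTime A X}.indicator 1 X ∂chainLaw J h β σ :=
        lintegral_congr fun X => toENNReal_eq_tsum_indicator _
    _ = ∑' n : ℕ, chainLaw J h β σ {X | (n : ℕ∞) < hitTime A X} := by
        rw [lintegral_tsum fun n =>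
          (measurable_one.indicator (measurableSet_lt_hitTime n)).aemeasurable]
        exact tsum_congr fun n => lintegral_indicator_one (measurableSet_lt_hitTime n)
    _ = ∑' n, ENNReal.ofReal (survival (transProb J h β) A n σ) :=
        tsum_congr fun n => chainLaw_lt_hitTime J h β hσ n

end HittingTime

lemma tendsto_mul_sub_exp_mul_div_atBot (W : ℝ) {κ K : ℝ} (hκ : 0 < κ) (hK : 0 < K) :
    Tendsto (fun x : ℝ => x * W - Real.exp (x * κ) / K) atTop atBot := by
  have hlin : Tendsto (fun x : ℝ => W - x * (κ ^ 2 / (2 * K))) atTop atBot :=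
    tendsto_atBot_add_const_left _ W
      (tendsto_neg_atTop_atBot.comp (tendsto_id.atTop_mul_const (by positivity)))
  refine tendsto_atBot_mono' _ ?_ (tendsto_id.atTop_mul_atBot₀ hlin)
  filter_upwards [eventually_ge_atTop 0] with x hx
  have hexp : (x * κ) ^ 2 / 2 ≤ Real.exp (x * κ) := by
    linarith [Real.quadratic_le_exp_of_nonneg (mul_nonneg hx hκ.le), mul_nonneg hx hκ.le]
  calc x * W - Real.exp (x * κ) / K
      ≤ x * W - (x * κ) ^ 2 / 2 / K := by gcongr
    _ = x * (W - x * (κ ^ 2 / (2 * K))) := by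
        field_simp

/-- An even time of order `exp (β V)`, the Arrhenius scale of an energy barrier `V`. -/
noncomputable def arrheniusTime (V : ℝ) (β : ℝ≥0) : ℕ := 2 * ⌈Real.exp (β * V)⌉₊

lemma arrheniusTime_pos (V : ℝ) (β : ℝ≥0) : 0 < arrheniusTime V β :=
  Nat.mul_pos two_pos (Nat.ceil_pos.2 (Real.exp_pos _))

lemma arrheniusTime_le {V : ℝ} (hV : 0 ≤ V) (β : ℝ≥0) :
    (arrheniusTime V β : ℝ) ≤ 4 * Real.exp (β * V) := by
  have hceil := Nat.ceil_lt_add_one (Real.exp_pos (β * V)).le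
  have hone : 1 ≤ Real.exp (β * V) := Real.one_le_exp (mul_nonneg β.coe_nonneg hV)
  rw [arrheniusTime]
  push_cast
  linarith

lemma tendsto_coe_nnreal_atTop : Tendsto (fun β : ℝ≥0 => (β : ℝ)) atTop atTop :=
  NNReal.tendsto_coe_atTop.2 tendsto_id

variable {L : ℕ}

lemma allMinus_notMem : allMinus L ∉ ({allPlus L} : Set (Config L)) := fun H =>
  absurd (congrFun H (Sum.inl (0, 0))) (by simp [allMinus, allPlus])

variable [NeZero L] {J h V : ℝ}

lemma exists_tendsto_zero_survival_arrheniusTime_le {B : Set (Config L)} {V₀ : ℝ}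
    (hB : ∀ σ, ∃ η ∈ B, Reach J h (energy J h σ + V₀) σ η) (hV : V₀ < V) :
    ∃ ε : ℝ≥0 → ℝ, Tendsto ε atTop (𝓝 0) ∧
      ∀ β σ, survival (transProb J h β) B (arrheniusTime V β) σ ≤ ε β := by
  obtain ⟨K, W, hK, hsurvival⟩ := exists_survival_le hB
  refine ⟨fun β => Fintype.card (Config L)
    * Real.exp (β * W - Real.exp (β * (V - V₀)) / K), ?_, fun β σ => (hsurvival β _ σ).trans ?_⟩
  · have hbot := (tendsto_mul_sub_exp_mul_div_atBot W (sub_pos.2 hV) hK).comp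
      tendsto_coe_nnreal_atTop
    simpa using (Real.tendsto_exp_atBot.comp hbot).const_mul (Fintype.card (Config L) : ℝ)
  · refine mul_le_mul_of_nonneg_left (Real.exp_le_exp.2 (sub_le_sub_left ?_ _)) (Nat.cast_nonneg _)
    calc Real.exp (β * (V - V₀)) / K
        = Real.exp (β * V) / (K * Real.exp (β * V₀)) := by
          rw [mul_sub, Real.exp_sub, div_div, mul_comm K]
      _ ≤ ⌈Real.exp (β * V)⌉₊ / (K * Real.exp (β * V₀)) := by
          gcongr
          exact Nat.le_ceil _

lemma tendsto_survival_allPlus_arrheniusTime (hL : 2 ≤ L) (hV₀ : 0 ≤ V) (hV : V < 3 * J - h) :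
    Tendsto (fun β => survival (transProb J h β) {allPlus L}
      (arrheniusTime V β + arrheniusTime V β) (allMinus L)) atTop (𝓝 1) := by
  have hP (β : ℝ≥0) := transProb_mem_rowStochastic (L := L) J h β
  have hlower (β : ℝ≥0) : 1 - 8 * Real.exp (-(β * (3 * J - h - V)))
      ≤ survival (transProb J h β) {allPlus L} (arrheniusTime V β + arrheniusTime V β)
          (allMinus L) := by
    rw [sub_le_comm]
    calc 1 - survival (transProb J h β) {allPlus L} (arrheniusTime V β + arrheniusTime V β)
          (allMinus L)
        ≤ (arrheniusTime V β + arrheniusTime V β : ℕ)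
            * (1 - transProb J h β (allMinus L) (allMinus L)) :=
          one_sub_survival_le (hP β) allMinus_notMem _
      _ ≤ (8 * Real.exp (β * V)) * Real.exp (-(β * (3 * J - h))) := by
          refine mul_le_mul ?_ (one_sub_transProb_allMinus_le hL (by linarith) β) ?_ (by positivity)
          · push_cast
            linarith [arrheniusTime_le hV₀ β]
          · exact sub_nonneg.2 (Matrix.le_one_of_mem_rowStochastic (hP β))
      _ = 8 * Real.exp (-(β * (3 * J - h - V))) := by
          rw [mul_assoc, ← Real.exp_add]
          ring_nf
  have hlim : Tendsto (fun β : ℝ≥0 => 1 - 8 * Real.exp (-(β * (3 * J - h - V)))) atTop (𝓝 1) := by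
    have hbot := tendsto_neg_atTop_atBot.comp
      (tendsto_coe_nnreal_atTop.atTop_mul_const (sub_pos.2 hV))
    simpa using ((Real.tendsto_exp_atBot.comp hbot).const_mul 8).const_sub 1
  exact tendsto_of_tendsto_of_tendsto_of_le_of_le hlim tendsto_const_nhds hlower
    fun β => survival_le_one (hP β) _ _

lemma exists_survival_allPlus_le (J h : ℝ) (β : ℝ≥0) :
    ∃ n, survival (transProb J h β) {allPlus L} n (allMinus L) ≤ Real.exp (-1) := by
  obtain ⟨V, hV⟩ := exists_forall_reach_allPlus (L := L) J h
  obtain ⟨K, W, hK, hsurvival⟩ := exists_survival_le hV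
  have hlim : Tendsto (fun n : ℕ => Fintype.card (Config L)
      * Real.exp (β * W - n / (K * Real.exp (β * V)))) atTop (𝓝 0) := by
    have hbot : Tendsto (fun n : ℕ => β * W - n / (K * Real.exp (β * V))) atTop atBot :=
      tendsto_atBot_add_const_left _ _ (tendsto_neg_atTop_atBot.comp
        (tendsto_natCast_atTop_atTop.atTop_div_const (by positivity)))
    simpa using (Real.tendsto_exp_atBot.comp hbot).const_mul (Fintype.card (Config L) : ℝ)
  obtain ⟨n, hn⟩ := (hlim.eventually_le_const (Real.exp_pos (-1))).exists
  exact ⟨2 * n, (hsurvival β n _).trans hn⟩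

lemma isLeast_quantileTime (J h : ℝ) (β : ℝ≥0) :
    IsLeast {n | survival (transProb J h β) {allPlus L} n (allMinus L) ≤ Real.exp (-1)}
      (quantileTime L J h β) := by
  have hset : {n : ℕ | 1 ≤ n ∧ 1 - Real.exp (-1)
        ≤ (chainLaw J h β (allMinus L)).real {X | hitTime {allPlus L} X ≤ n}}
      = {n | survival (transProb J h β) {allPlus L} n (allMinus L) ≤ Real.exp (-1)} := by
    ext n
    simp only [Set.mem_ofPred_eq, chainLaw_real_hitTime_le J h β allMinus_notMem,
      sub_le_sub_iff_left, and_iff_right_iff_imp]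
    intro hn
    rw [Nat.one_le_iff_ne_zero]
    rintro rfl
    have hone : survival (transProb J h β) {allPlus L} 0 (allMinus L) = 1 :=
      survival_zero allMinus_notMem
    linarith [Real.exp_lt_one_iff.2 (neg_one_lt_zero (R := ℝ))]
  rw [quantileTime, hset]
  exact ⟨Nat.sInf_mem (exists_survival_allPlus_le J h β), fun n hn => Nat.sInf_le hn⟩

lemma ofReal_lt_coe_iff {x : ℝ} (hx : 0 ≤ x) (N : ℕ∞) :
    ENNReal.ofReal x < (N : ℝ≥0∞) ↔ (⌊x⌋₊ : ℕ∞) < N := by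
  induction N using ENat.recTopCoe with
  | top => simp
  | coe n =>
    rw [ENat.toENNReal_coe, Nat.cast_lt, Nat.floor_lt hx, ← ENNReal.ofReal_natCast,
      ENNReal.ofReal_lt_ofReal_iff', and_iff_left_of_imp fun h => hx.trans_lt h]

lemma two_le_of_sq_le_card (hh : 0 < h) (hJ : 2 * h ≤ J)
    (hL : (4 * J / h) ^ 2 ≤ Fintype.card (Site L)) : 2 ≤ L := by
  by_contra! hlt
  obtain rfl : L = 1 := by
    have := NeZero.ne L
    lia
  have hcard : (Fintype.card (Site 1) : ℝ) = 2 := by simp [Fintype.card_sum]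
  have hratio : 8 ≤ 4 * J / h := by
    rw [le_div_iff₀ hh]
    linarith
  nlinarith

end HexIsing

open HexIsing in
theorem theorem4_general (L : ℕ) [NeZero L] (J h : ℝ) (hL : 2 ≤ L) (hh : 0 < h) (hhJ : h < J) :
    (∀ t : ℝ, 0 ≤ t →
      Tendsto (fun β : ℝ≥0 => (chainLaw J h β (allMinus L)).real
          {X | ENNReal.ofReal (t * quantileTime L J h β)
            < (hitTime {allPlus L} X : ℝ≥0∞)})
        atTop (𝓝 (Real.exp (-t)))) ∧
    Tendsto (fun β : ℝ≥0 => meanHitTime L J h β / (quantileTime L J h β : ℝ≥0∞))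
      atTop (𝓝 1) := by
  obtain ⟨V, hV₁, hV₂⟩ := exists_between (show 2 * J < 3 * J - h by linarith)
  obtain ⟨ε, hε_lim, hε⟩ := exists_tendsto_zero_survival_arrheniusTime_le
    (exists_reach_const hL hh hhJ) hV₁
  have hexit := tendsto_survival_allPlus_arrheniusTime hL (by linarith) hV₂
  have hP (β : ℝ≥0) := transProb_mem_rowStochastic (L := L) J h β
  have hT := isLeast_quantileTime (L := L) J h
  have hR := arrheniusTime_pos V
  refine ⟨fun t ht => ?_, ?_⟩
  · refine (tendsto_survival_floor_mul hP allMinus_notMem hR hε hε_lim hexit hT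
      ht).congr fun β => ?_
    simp only [← chainLaw_real_lt_hitTime J h β allMinus_notMem,
      ofReal_lt_coe_iff (mul_nonneg ht (Nat.cast_nonneg _))]
  · refine (tendsto_tsum_survival_div hP allMinus_notMem hR hε hε_lim hexit
      hT).congr fun β => ?_
    rw [meanHitTime, lintegral_hitTime J h β allMinus_notMem]

theorem theorem4 (L : ℕ) [NeZero L] (J h : ℝ) (hh0 : 0 < h) (hh1 : h < 1) (hJ : 2 * h ≤ J)
    (hJh : ∀ k : ℤ, J / (2 * h) - 1 / 2 ≠ k)
    (hL : (4 * J / h) ^ 2 ≤ (Fintype.card (HexIsing.Site L) : ℝ)) :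
    (∀ t : ℝ, 0 ≤ t →
      Tendsto (fun β : ℝ≥0 => (HexIsing.chainLaw J h β (HexIsing.allMinus L)).real
          {X | ENNReal.ofReal (t * HexIsing.quantileTime L J h β)
            < (HexIsing.hitTime {HexIsing.allPlus L} X : ℝ≥0∞)})
        atTop (𝓝 (Real.exp (-t)))) ∧
    Tendsto (fun β : ℝ≥0 => HexIsing.meanHitTime L J h β / (HexIsing.quantileTime L J h β : ℝ≥0∞))
      atTop (𝓝 1) :=
  theorem4_general L J h (HexIsing.two_le_of_sq_le_card hh0 hJ hL) hh0 (by linarith)
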